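/- **Setting.** $M$ clients have importances $p_i\ge 0$, $\sum_{i=1}^M p_i=1$, and differentiable local losses $\mathcal L_i:\mathbb R^d\to\mathbb R$. Every client performs $K$ local steps with local learning rate $\eta_l>0$; $\eta_g>0$ is the server learning rate and $\tilde\eta=\eta_g\eta_l$. Client $i$ has a coefficient vector ${\bm a}_i=(a_{i,0},\dots,a_{i,K-1})$ with non-negative entries; write $a_i=\|{\bm a}_i\|_1$ and $a_{i,-1}=a_{i,K-1}$ (its last entry). In round $t$ client $i$ starts from the global model $\theta^t$ and computes local models $$y_{i,k}^t=\theta^t-\eta_l\sum_{s<k}c_{i,k,s}\,g_i(y_{i,s}^t,\xi_{i,s}^t),\qquad 0\le k<K,$$ where $g_i$ are stochastic gradients, $\xi_{i,s}^t$ are batches, and the weights satisfy $0\le c_{i,k,s}\le a_{i,s}$ for $s<k<K$ (for instance $c_{i,k,s}=a_{i,s}$, i.e. $y_{i,k+1}^t=y_{i,k}^t-\eta_l a_{i,k}g_i(y_{i,k}^t,\xi_{i,k}^t)$; momentum SGD is also of this form). The contribution of client $i$ is $\theta_i^{t+1}-\theta^t=-\eta_l\sum_{k=0}^{K-1}a_{i,k}\,g_i(y_{i,k}^t,\xi_{i,k}^t)$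 and, starting from a fixed $\theta^0$, $$\theta^{t+1}=\theta^t+\eta_g\sum_{i=1}^M\omega_i(S_t)\,(\theta_i^{t+1}-\theta^t),$$ where $S_t$ are the random sampling outcomes and $\omega_i(S_t)$ the aggregation weights. All $S_t$ and all batches are mutually independent; the $S_t$ are identically distributed, and $\xi_{i,k}^t$ has a law depending only on $i$. Put $$K_{eff}=\sum_{i=1}^M p_ia_i,\qquad q_i=\frac{p_ia_i}{K_{eff}},\qquad \mathcal L=\sum_{i=1}^M q_i\mathcal L_i,$$ and assume $K_{eff}>0$ (if all $a_i$ are equal, $q_i=p_i$). Let $\theta^*$ be a minimiser of $\mathcal L$. **Assumptions.** 1. (Smoothness) Every $\nabla\mathcal L_i$ is $L$-Lipschitz. 2. (Unbiased gradients, bounded variance) For every $i$ and $x$, $g_i(x,\xi)$ is square integrable, $\mathbb E[g_i(x,\xi)]=\nabla\mathcal L_i(x)$ and $\mathbb E\|g_i(x,\xi)-\nabla\mathcal L_i(x)\|^2\le\sigma^2$. 3. (Bounded dissimilarity) There are $\beta\ge 1$ and $\kappa$ such that for all weights $w_i\ge0$ with $\sum_i w_i=1$ and all $x$, $\sum_i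 w_i\|\nabla\mathcal L_i(x)\|^2\le\beta^2\|\nabla\mathcal L(x)\|^2+\kappa^2$. 4. (Client sampling) The weights are square integrable, $\mathbb E[\omega_i]=p_i$, $\mathrm{Cov}(\omega_i,\omega_j)=-\alpha p_ip_j$ for $i\ne j$, and $\gamma_i=\mathrm{Var}[\omega_i]+\alpha p_i^2\ge0$ for every $i$ (automatic if $\alpha\ge0$). **Auxiliary quantities.** For an integer $m\ge1$ (the number of sampled clients), let $$A=\frac{m}{K_{eff}}\sum_{i=1}^M\big(\mathrm{Var}[\omega_i]+p_i^2\big)\|{\bm a}_i\|_2^2,\qquad B=\sum_{i=1}^M q_i\big(\|{\bm a}_i\|_2^2-a_{i,-1}^2\big),\qquad C=\max_i\{a_i(a_i-a_{i,-1})\},$$ $$D=\frac{C}{K_{eff}}\Big(\sum_{i=1}^M\mathrm{Var}[\omega_i]+\alpha\sum_{i=1}^M p_i^2\Big),\qquad E=\frac{\max_i a_i^2}{K_{eff}}\Big(\sum_{i=1}^M\mathrm{Var}[\omega_i]+\alpha\sum_{i=1}^M p_i^2\Big),$$ $\Omega=4L\tilde\eta\beta^2E$, and $X'=X/(1-\Omega)$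 for $X\in\{A,B,C,D,E\}$. **Theorem.** Suppose that the learning rates are small enough that $L\tilde\eta(1-\alpha)K_{eff}\le1$, $32\,\eta_l^2L^2\beta^2C\le1$ and $\Omega<1$. Then $\mathbb E\|\nabla\mathcal L(\theta^t)\|^2<\infty$ for every $t$ and, for every $T\ge1$, $$\frac1T\sum_{t=0}^{T-1}\mathbb E\|\nabla\mathcal L(\theta^t)\|^2\le 4\,\frac{\mathcal L(\theta^0)-\mathcal L(\theta^*)}{(1-\Omega)\,\tilde\eta\,K_{eff}\,T}+2L\tilde\eta A'\frac{\sigma^2}{m}+3\eta_l^2L^2B'\sigma^2+6\eta_l^2L^2C'\kappa^2+3L\tilde\eta D'\sigma^2+4L\Big[\frac{L^2}{2}+1\Big]\tilde\eta E'\kappa^2 .$$ -/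

import Mathlib

open MeasureTheory ProbabilityTheory

noncomputable section

namespace FedLearning

/-- The parameter space. -/
abbrev Param (d : ℕ) := EuclideanSpace ℝ (Fin d)

/-! ### The algorithm, along one realisation of the randomness -/

/-- The local models of one client during one round.  The client starts from the global model `θ`;
after `k` steps its model is `y k = θ - ηl • ∑_{s < k} c k s • g (y s) (ζ s)`, where `g (y s) (ζ s)`
is the stochastic gradient computed at step `s` on the batch `ζ s`.
With `c k s = a s` this is `y (k + 1) = y k - (ηl * a k) • g (y k) (ζ k)` (vanilla SGD: `a = 1`);
a momentum buffer of parameter `ρ` corresponds to `c k s = (1 - ρ ^ (k - s)) / (1 - ρ)`. -/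
def localModel {d : ℕ} {Z : Type*} (ηl : ℝ) (c : ℕ → ℕ → ℝ) (g : Param d → Z → Param d)
    (ζ : ℕ → Z) (θ : Param d) : ℕ → Param d
  | k => θ - ηl • ∑ s : Fin k, c k s • g (localModel ηl c g ζ θ s) (ζ s)
termination_by k => k
decreasing_by exact s.isLt

/-- The contribution `θ_i^{t+1} - θ^t` of one client after `K` local steps:
`- ηl • ∑_{k < K} a k • g (y k) (ζ k)`. -/
def localUpdate {d : ℕ} {Z : Type*} (ηl : ℝ) (K : ℕ) (a : ℕ → ℝ) (c : ℕ → ℕ → ℝ)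
    (g : Param d → Z → Param d) (ζ : ℕ → Z) (θ : Param d) : Param d :=
  -(ηl • ∑ k ∈ Finset.range K, a k • g (localModel ηl c g ζ θ k) (ζ k))

/-- The global models `θ^0, θ^1, …`: with `w t i` the aggregation weight of client `i` in round `t`,
`θ^{t+1} = θ^t + ηg • ∑ i, w t i • (θ_i^{t+1} - θ^t)`. -/
def globalModel {d M : ℕ} {Z : Type*} (ηg ηl : ℝ) (K : ℕ) (a : Fin M → ℕ → ℝ)
    (c : Fin M → ℕ → ℕ → ℝ) (g : Fin M → Param d → Z → Param d) (θ₀ : Param d)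
    (w : ℕ → Fin M → ℝ) (ζ : ℕ → Fin M → ℕ → Z) : ℕ → Param d
  | 0 => θ₀
  | t + 1 =>
      globalModel ηg ηl K a c g θ₀ w ζ t + ηg • ∑ i, w t i •
        localUpdate ηl K (a i) (c i) (g i) (ζ t i) (globalModel ηg ηl K a c g θ₀ w ζ t)

/-! ### Scalars attached to the coefficient vectors `a i = (a i 0, …, a i (K - 1))` -/

/-- `‖a‖₁`. -/
def norm1 (K : ℕ) (a : ℕ → ℝ) : ℝ := ∑ k ∈ Finset.range K, |a k|

/-- `‖a‖₂²`. -/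
def norm2sq (K : ℕ) (a : ℕ → ℝ) : ℝ := ∑ k ∈ Finset.range K, a k ^ 2

/-- The last entry `a_{-1}` of `a` (used for `K ≥ 1` only). -/
def lastCoeff (K : ℕ) (a : ℕ → ℝ) : ℝ := a (K - 1)

/-- The effective number of local steps `K_eff = ∑ i, p i * ‖a i‖₁`. -/
def Keff {M : ℕ} (K : ℕ) (p : Fin M → ℝ) (a : Fin M → ℕ → ℝ) : ℝ :=
  ∑ i, p i * norm1 K (a i)

/-- The effective importance `q i = p i * ‖a i‖₁ / K_eff` of client `i`. -/
def effWeight {M : ℕ} (K : ℕ) (p : Fin M → ℝ) (a : Fin M → ℕ → ℝ) (i : Fin M) : ℝ :=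
  p i * norm1 K (a i) / Keff K p a

/-- The loss that is optimised, `x ↦ ∑ i, q i * f i x`; it is `x ↦ ∑ i, p i * f i x` when all the
`‖a i‖₁` are equal, as for FedAvg. -/
def globalLoss {d M : ℕ} (K : ℕ) (p : Fin M → ℝ) (a : Fin M → ℕ → ℝ)
    (f : Fin M → Param d → ℝ) (x : Param d) : ℝ :=
  ∑ i, effWeight K p a i * f i x

/-! ### The client sampling scheme: a random outcome `s` with law `ν`, giving the aggregation
weights `ω s i` -/

/-- `γ i = Var[ω i] + α * p i ^ 2`. -/
def gam {M : ℕ} {𝒮 : Type*} [MeasurableSpace 𝒮] (ν : Measure 𝒮) (ω : 𝒮 → Fin M → ℝ)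
    (p : Fin M → ℝ) (α : ℝ) (i : Fin M) : ℝ :=
  variance (fun s => ω s i) ν + α * p i ^ 2

/-- The scheme is unbiased, `E[ω i] = p i`, with square integrable weights, and
`Cov(ω i, ω j) = - α * p i * p j` for `i ≠ j`. -/
structure SamplingScheme {M : ℕ} {𝒮 : Type*} [MeasurableSpace 𝒮] (ν : Measure 𝒮)
    (ω : 𝒮 → Fin M → ℝ) (p : Fin M → ℝ) (α : ℝ) : Prop where
  measurable : ∀ i, Measurable fun s => ω s i
  memLp : ∀ i, MemLp (fun s => ω s i) 2 ν
  unbiased : ∀ i, ∫ s, ω s i ∂ν = p i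
  cov_eq : ∀ i j, i ≠ j → covariance (fun s => ω s i) (fun s => ω s j) ν = -α * p i * p j

/-! ### Assumptions on the clients -/

/-- The local loss is differentiable with an `L`-Lipschitz gradient. -/
def Smooth {d : ℕ} (L : ℝ) (f : Param d → ℝ) : Prop :=
  Differentiable ℝ f ∧ ∀ x y, ‖gradient f x - gradient f y‖ ≤ L * ‖x - y‖

/-- `g x z`, with a batch `z` of law `D`, is an unbiased estimator of the gradient of `f` at every
`x`, with variance at most `σ ^ 2`. -/
structure StochasticGradient {d : ℕ} {Z : Type*} [MeasurableSpace Z] (D : Measure Z) (σ : ℝ)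
    (f : Param d → ℝ) (g : Param d → Z → Param d) : Prop where
  measurable : Measurable fun q : Param d × Z => g q.1 q.2
  memLp : ∀ x, MemLp (g x) 2 D
  unbiased : ∀ x, ∫ z, g x z ∂D = gradient f x
  variance_le : ∀ x, ∫ z, ‖g x z - gradient f x‖ ^ 2 ∂D ≤ σ ^ 2

/-- Bounded dissimilarity of the local losses `f i` with respect to the global loss `F`: every
weighted mean of the `‖∇ f i x‖ ^ 2` is at most `β ^ 2 * ‖∇ F x‖ ^ 2 + κ ^ 2`. -/
def BoundedDissimilarity {d M : ℕ} (β κ : ℝ) (f : Fin M → Param d → ℝ) (F : Param d → ℝ) : Prop :=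
  ∀ w : Fin M → ℝ, (∀ i, 0 ≤ w i) → ∑ i, w i = 1 →
    ∀ x, ∑ i, w i * ‖gradient (f i) x‖ ^ 2 ≤ β ^ 2 * ‖gradient F x‖ ^ 2 + κ ^ 2

/-- The sampling outcomes `S t` are independent with law `ν`, the batches `ξ (t, i, k)` (round `t`,
client `i`, local step `k`) are independent with law `D i`, and the outcomes are independent of the
batches. -/
structure RandomInputs {M : ℕ} {Ω 𝒮 Z : Type*} [MeasurableSpace Ω] [MeasurableSpace 𝒮]
    [MeasurableSpace Z] (P : Measure Ω) (ν : Measure 𝒮) (D : Fin M → Measure Z)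
    (S : ℕ → Ω → 𝒮) (ξ : ℕ × Fin M × ℕ → Ω → Z) : Prop where
  measurable_S : ∀ t, Measurable (S t)
  law_S : ∀ t, P.map (S t) = ν
  measurable_ξ : ∀ j, Measurable (ξ j)
  law_ξ : ∀ j, P.map (ξ j) = D j.2.1
  indep_S : iIndepFun S P
  indep_ξ : iIndepFun ξ P
  indep_S_ξ : IndepFun (fun o t => S t o) (fun o j => ξ j o) P

/-! ### The auxiliary quantities -/

/-- `A = m / K_eff * ∑ i, (Var[ω i] + p i ^ 2) * ‖a i‖₂²`. -/
def constA {M : ℕ} {𝒮 : Type*} [MeasurableSpace 𝒮] (ν : Measure 𝒮) (ω : 𝒮 → Fin M → ℝ)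
    (m K : ℕ) (p : Fin M → ℝ) (a : Fin M → ℕ → ℝ) : ℝ :=
  m * (1 / Keff K p a) *
    ∑ i, (variance (fun s => ω s i) ν + p i ^ 2) * norm2sq K (a i)

/-- `B = ∑ i, q i * (‖a i‖₂² - a_{i,-1}²)`. -/
def constB {M : ℕ} (K : ℕ) (p : Fin M → ℝ) (a : Fin M → ℕ → ℝ) : ℝ :=
  ∑ i, effWeight K p a i * (norm2sq K (a i) - lastCoeff K (a i) ^ 2)

/-- `C = max_i ‖a i‖₁ * (‖a i‖₁ - a_{i,-1})`. -/
def constC {M : ℕ} (K : ℕ) (a : Fin M → ℕ → ℝ) : ℝ :=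
  ⨆ i, norm1 K (a i) * (norm1 K (a i) - lastCoeff K (a i))

/-- `D = C / K_eff * (∑ i, Var[ω i] + α * ∑ i, p i ^ 2)`. -/
def constD {M : ℕ} {𝒮 : Type*} [MeasurableSpace 𝒮] (ν : Measure 𝒮) (ω : 𝒮 → Fin M → ℝ)
    (K : ℕ) (p : Fin M → ℝ) (a : Fin M → ℕ → ℝ) (α : ℝ) : ℝ :=
  1 / Keff K p a * constC K a *
    ((∑ i, variance (fun s => ω s i) ν) + α * ∑ i, p i ^ 2)

/-- `E = max_i ‖a i‖₁² / K_eff * (∑ i, Var[ω i] + α * ∑ i, p i ^ 2)`. -/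
def constE {M : ℕ} {𝒮 : Type*} [MeasurableSpace 𝒮] (ν : Measure 𝒮) (ω : 𝒮 → Fin M → ℝ)
    (K : ℕ) (p : Fin M → ℝ) (a : Fin M → ℕ → ℝ) (α : ℝ) : ℝ :=
  1 / Keff K p a * (⨆ i, norm1 K (a i) ^ 2) *
    ((∑ i, variance (fun s => ω s i) ν) + α * ∑ i, p i ^ 2)

/-- `Ω = 4 * L * (ηg * ηl) * β ^ 2 * E`. -/
def constOmega {M : ℕ} {𝒮 : Type*} [MeasurableSpace 𝒮] (ν : Measure 𝒮) (ω : 𝒮 → Fin M → ℝ)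
    (K : ℕ) (p : Fin M → ℝ) (a : Fin M → ℕ → ℝ) (α L β ηg ηl : ℝ) : ℝ :=
  4 * L * (ηg * ηl) * β ^ 2 * constE ν ω K p a α

end FedLearning

end

/-! Write η = ηg ηl and F for the global loss. A round is a perturbed gradient step θ' = θ - η ∑ ω_i
G_i, where G_i is the weighted sum of the stochastic gradients of client i. Split G_i = H_i + N_i
and H_i = ‖a_i‖₁ ∇f_i(θ) + V_i: N_i collects the gradient noise and V_i the change of the gradient
caused by the drift of the local models. Since p_i ‖a_i‖₁ = K_eff q_i, the mean direction is ∑ p_i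
H_i = K_eff ∇F(θ) + ∑ p_i V_i. Insert the step into the quadratic upper bound for F and take
expectations.

First-order term. Weights and noise average out, and polarisation gives -η/(2 K_eff) (K_eff² E‖∇F‖²
+ X - R) with X = E‖∑ p_i H_i‖² and R = E‖∑ p_i V_i‖² (`integral_inner_sum_sumGrad`).

Second-order term. The matrix E[ω_i ω_j] equals (1-α) p_i p_j plus the diagonal γ_i, and the noise
of one client is orthogonal to everything another client does. Hence E‖∑ ω_i G_i‖² is (1-α) X plus
diagonal terms (`integral_norm_sum_weights_sq_le`). The first step-size condition lets the -X above
absorb (1-α) X. On the diagonal, E‖G_i‖² - E‖H_i‖² is not just E‖N_i‖², because V_i depends on the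
earlier noises of the same client; the cross term is paid for by E‖V_i‖².

Drift. R and E‖V_i‖² are bounded by the squared distances of the local models from θ, which satisfy
a recursive inequality. The second step-size condition closes it (`sum_drift_le`), leaving σ² and
E‖∇f_i(θ)‖², and bounded dissimilarity turns the latter into β² E‖∇F‖² + κ².

The constants are collected in `client_second_moment_le` and `round_arithmetic`, and the resulting
decrease of E F is telescoped in `average_le_of_descent`. All probabilistic cancellations come from
Fubini: a batch is independent of the σ-algebra of all the other inputs, so the remaining arguments
can be frozen. -/

namespace FedLearning

/-! ### Smooth functions -/

/-- The quadratic upper bound for a function with Lipschitz gradient. -/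
theorem Smooth.le_quadratic {d : ℕ} {L : ℝ} {F : Param d → ℝ} (h : Smooth L F) (x y : Param d) :
    F y ≤ F x + inner ℝ (gradient F x) (y - x) + L / 2 * ‖y - x‖ ^ 2 := by
  obtain ⟨hd, hl⟩ := h
  set v := y - x with hv
  have hline : ∀ t : ℝ, HasDerivAt (fun t : ℝ => x + t • v) v t := fun t => by
    simpa using ((hasDerivAt_id t).smul_const v).const_add x
  have hF : ∀ t : ℝ, HasDerivAt (fun t : ℝ => F (x + t • v))
      (inner ℝ (gradient F (x + t • v)) v) t := fun t => by
    have h1 := (hd (x + t • v)).hasGradientAt.hasFDerivAt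
    exact (h1.comp_hasDerivAt t (hline t)).congr_deriv (by simp)
  -- The claim is `φ 1 ≤ φ 0`. The subtracted quadratic dominates the growth of the directional
  -- derivative allowed by the Lipschitz bound, so `φ` decreases.
  let φ : ℝ → ℝ := fun t =>
    F (x + t • v) - t * inner ℝ (gradient F x) v - L / 2 * ‖v‖ ^ 2 * t ^ 2
  have hφ : ∀ t : ℝ, HasDerivAt φ (inner ℝ (gradient F (x + t • v)) v
      - inner ℝ (gradient F x) v - L * ‖v‖ ^ 2 * t) t := fun t => by
    have h2 := ((hF t).sub ((hasDerivAt_id t).mul_const (inner ℝ (gradient F x) v))).sub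
      ((hasDerivAt_pow 2 t).const_mul (L / 2 * ‖v‖ ^ 2))
    refine h2.congr_deriv ?_
    simp only [Nat.cast_ofNat, one_mul, Nat.add_one_sub_one, pow_one]
    ring
  have hanti : AntitoneOn φ (Set.Icc 0 1) := by
    apply antitoneOn_of_deriv_nonpos (convex_Icc 0 1)
    · exact fun t _ => (hφ t).continuousAt.continuousWithinAt
    · exact fun t _ => (hφ t).differentiableAt.differentiableWithinAt
    · intro t ht
      rw [interior_Icc] at ht
      rw [(hφ t).deriv, ← inner_sub_left]
      have h3 := real_inner_le_norm (gradient F (x + t • v) - gradient F x) v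
      have h4 := hl (x + t • v) x
      rw [add_sub_cancel_left, norm_smul, Real.norm_of_nonneg ht.1.le] at h4
      have h5 := mul_le_mul_of_nonneg_right h4 (norm_nonneg v)
      nlinarith
  have h6 := hanti (Set.left_mem_Icc.2 zero_le_one) (Set.right_mem_Icc.2 zero_le_one) zero_le_one
  simp only [φ, one_smul, zero_smul, add_zero, hv, add_sub_cancel] at h6
  linarith

theorem Smooth.measurable_gradient {d : ℕ} {L : ℝ} {F : Param d → ℝ} (h : Smooth L F) :
    Measurable (gradient F) := by
  have : LipschitzWith L.toNNReal (gradient F) :=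
    LipschitzWith.of_dist_le_mul fun x y => by
      rw [dist_eq_norm, dist_eq_norm]
      exact (h.2 x y).trans (by gcongr; exact Real.le_coe_toNNReal L)
  exact this.continuous.measurable

theorem hasGradientAt_sum_mul {d M : ℕ} {q : Fin M → ℝ} {f : Fin M → Param d → ℝ}
    (hf : ∀ i, Differentiable ℝ (f i)) (x : Param d) :
    HasGradientAt (fun x => ∑ i, q i * f i x) (∑ i, q i • gradient (f i) x) x := by
  rw [hasGradientAt_iff_hasFDerivAt]
  have h : HasFDerivAt (fun x => ∑ i, q i * f i x) (∑ i, q i • fderiv ℝ (f i) x) x :=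
    HasFDerivAt.fun_sum fun i _ => ((hf i x).hasFDerivAt).const_mul (q i)
  exact h.congr_fderiv (by simp [map_sum, gradient])

theorem gradient_globalLoss {d M : ℕ} (K : ℕ) (p : Fin M → ℝ) (a : Fin M → ℕ → ℝ)
    {f : Fin M → Param d → ℝ} (hf : ∀ i, Differentiable ℝ (f i)) (x : Param d) :
    gradient (globalLoss K p a f) x = ∑ i, effWeight K p a i • gradient (f i) x :=
  (hasGradientAt_sum_mul hf x).gradient

theorem smooth_globalLoss {d M : ℕ} {K : ℕ} {p : Fin M → ℝ} {a : Fin M → ℕ → ℝ}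
    {f : Fin M → Param d → ℝ} {L : ℝ} (hf : ∀ i, Smooth L (f i))
    (hq : ∀ i, 0 ≤ effWeight K p a i) (hq1 : ∑ i, effWeight K p a i = 1) :
    Smooth L (globalLoss K p a f) := by
  refine ⟨fun x => (hasGradientAt_sum_mul (fun i => (hf i).1) x).differentiableAt, fun x y => ?_⟩
  rw [gradient_globalLoss K p a (fun i => (hf i).1), gradient_globalLoss K p a (fun i => (hf i).1),
    ← Finset.sum_sub_distrib]
  calc ‖∑ i, (effWeight K p a i • gradient (f i) x - effWeight K p a i • gradient (f i) y)‖
      ≤ ∑ i, effWeight K p a i * (L * ‖x - y‖) := by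
        refine norm_sum_le_of_le _ fun i _ => ?_
        rw [← smul_sub, norm_smul, Real.norm_of_nonneg (hq i)]
        exact mul_le_mul_of_nonneg_left ((hf i).2 x y) (hq i)
    _ = L * ‖x - y‖ := by rw [← Finset.sum_mul, hq1, one_mul]

/-- Jensen's inequality for the squared norm, with unnormalised weights. -/
theorem norm_sum_smul_sq_le {ι E : Type*} [NormedAddCommGroup E] [InnerProductSpace ℝ E]
    (s : Finset ι) (w : ι → ℝ) (hw : ∀ i ∈ s, 0 ≤ w i) (v : ι → E) :
    ‖∑ i ∈ s, w i • v i‖ ^ 2 ≤ (∑ i ∈ s, w i) * ∑ i ∈ s, w i * ‖v i‖ ^ 2 := by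
  have h1 : ‖∑ i ∈ s, w i • v i‖ ≤ ∑ i ∈ s, w i * ‖v i‖ :=
    norm_sum_le_of_le _ fun i hi => by rw [norm_smul, Real.norm_of_nonneg (hw i hi)]
  calc ‖∑ i ∈ s, w i • v i‖ ^ 2 ≤ (∑ i ∈ s, w i * ‖v i‖) ^ 2 := by gcongr
    _ ≤ (∑ i ∈ s, w i) * ∑ i ∈ s, w i * ‖v i‖ ^ 2 := by
      refine Finset.sum_sq_le_sum_mul_sum_of_sq_le_mul s hw
        (fun i hi => mul_nonneg (hw i hi) (sq_nonneg _)) fun i _ => by ring_nf; rfl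

/-! ### Partial sums of non-negative coefficients -/

/-- The sum is a left Riemann sum of the increasing function x² on [0, ∑ a]. -/
theorem sum_mul_sum_sq_le {a : ℕ → ℝ} {n : ℕ} (ha : ∀ k < n, 0 ≤ a k) :
    ∑ k ∈ Finset.range n, a k * (∑ s ∈ Finset.range k, a s) ^ 2
      ≤ (∑ s ∈ Finset.range n, a s) ^ 3 / 3 := by
  induction n with
  | zero => simp
  | succ n ih =>
    have h1 := ih fun k hk => ha k (by omega)
    have h2 : 0 ≤ ∑ s ∈ Finset.range n, a s :=
      Finset.sum_nonneg fun s hs => ha s (by have := Finset.mem_range.1 hs; omega)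
    have h3 := ha n (by omega)
    rw [Finset.sum_range_succ, Finset.sum_range_succ (fun s => a s)]
    have h4 : 0 ≤ (∑ s ∈ Finset.range n, a s) * a n ^ 2 := by positivity
    have h5 : 0 ≤ a n ^ 3 := by positivity
    nlinarith

/-- With b the sum without the last entry, bounding the first n terms by b³/3 leaves a gap of b (b -
3 a_n)² / 24. Keeping b as a factor produces the product ‖a‖₁ (‖a‖₁ - a_{-1}) of the step-size
condition. -/
theorem sum_succ_mul_sum_sq_le {a : ℕ → ℝ} {n : ℕ} (ha : ∀ k < n + 1, 0 ≤ a k) :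
    ∑ k ∈ Finset.range (n + 1), a k * (∑ s ∈ Finset.range k, a s) ^ 2
      ≤ 3 / 8 * (∑ s ∈ Finset.range (n + 1), a s) ^ 2 * ∑ s ∈ Finset.range n, a s := by
  have h1 := sum_mul_sum_sq_le (n := n) fun k hk => ha k (by omega)
  have h2 : 0 ≤ ∑ s ∈ Finset.range n, a s :=
    Finset.sum_nonneg fun s hs => ha s (by have := Finset.mem_range.1 hs; omega)
  rw [Finset.sum_range_succ, Finset.sum_range_succ (fun s => a s)]
  set b := ∑ s ∈ Finset.range n, a s
  have h3 : 0 ≤ b * (b - 3 * a n) ^ 2 := by positivity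
  nlinarith

theorem sum_sq_le_sq_sum_range {a : ℕ → ℝ} {n : ℕ} (ha : ∀ k < n, 0 ≤ a k) :
    ∑ k ∈ Finset.range n, a k ^ 2 ≤ (∑ k ∈ Finset.range n, a k) ^ 2 :=
  Finset.sum_sq_le_sq_sum_of_nonneg fun k hk => ha k (Finset.mem_range.1 hk)

/-- Let b and B be the sums of a_k and a_k² without the last entry. For a_n ≤ b/4 the left side is
at most 5/4 b B; otherwise B ≤ b² reduces the claim to b ((b - 2 a_n)² + a_n²) ≥ 0. This lets drift
noise be charged to ‖a‖₂², hence to the constant A. -/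
theorem sum_sq_mul_sum_le {a : ℕ → ℝ} {n : ℕ} (ha : ∀ k < n + 1, 0 ≤ a k) :
    (∑ k ∈ Finset.range n, a k ^ 2) * ∑ k ∈ Finset.range (n + 1), a k
      ≤ 5 / 4 * (∑ k ∈ Finset.range n, a k) * ∑ k ∈ Finset.range (n + 1), a k ^ 2 := by
  have h1 := sum_sq_le_sq_sum_range (n := n) fun k hk => ha k (by omega)
  have h2 : 0 ≤ ∑ s ∈ Finset.range n, a s :=
    Finset.sum_nonneg fun s hs => ha s (by have := Finset.mem_range.1 hs; omega)
  have h3 : 0 ≤ ∑ s ∈ Finset.range n, a s ^ 2 := Finset.sum_nonneg fun s _ => sq_nonneg _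
  have h4 := ha n (by omega)
  rw [Finset.sum_range_succ, Finset.sum_range_succ (fun s => a s ^ 2)]
  set b := ∑ s ∈ Finset.range n, a s
  set B := ∑ s ∈ Finset.range n, a s ^ 2
  have h6 : 0 ≤ b * a n ^ 2 := by positivity
  rcases le_total (a n) (b / 4) with h | h
  · nlinarith [mul_nonneg h3 (sub_nonneg.2 h)]
  · have h5 := mul_le_mul_of_nonneg_right h1 (sub_nonneg.2 h)
    nlinarith [mul_nonneg h2 (sq_nonneg (b - 2 * a n))]

/-! ### The recursive inequality for the client drift -/

/-- Here `W k` stands for the mean squared drift after k steps, `e` for ηl², `l` for L², `v` for σ²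
and `N` for E‖∇f(θ)‖². A crude uniform bound for `W` is proved first and then fed back once into the
recursion, where the weighted sum keeps the sharper cubic estimate. -/
theorem sum_drift_le {a W : ℕ → ℝ} {n : ℕ} {e l v N : ℝ} (ha : ∀ k < n + 1, 0 ≤ a k)
    (he : 0 ≤ e) (hl : 0 ≤ l) (hv : 0 ≤ v) (hN : 0 ≤ N)
    (hsmall : 32 * e * l *
      ((∑ s ∈ Finset.range (n + 1), a s) * ∑ s ∈ Finset.range n, a s) ≤ 1)
    (hW : ∀ k < n + 1, W k ≤ 2 * e * (v * ∑ s ∈ Finset.range k, a s ^ 2)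
      + 2 * e * ((∑ s ∈ Finset.range k, a s) *
        ∑ s ∈ Finset.range k, a s * (3 / 2 * N + 3 * l * W s))) :
    ∑ k ∈ Finset.range (n + 1), a k * W k ≤ (∑ s ∈ Finset.range (n + 1), a s) *
      (9 / 4 * e * (v * ∑ s ∈ Finset.range n, a s ^ 2) + 3 / 2 * e *
        ((∑ s ∈ Finset.range (n + 1), a s) * ∑ s ∈ Finset.range n, a s) * N) := by
  have hcube := sum_succ_mul_sum_sq_le ha
  have hAk0 : ∀ k ≤ n, 0 ≤ ∑ s ∈ Finset.range k, a s := fun k hk =>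
    Finset.sum_nonneg fun s hs => ha s (by have := Finset.mem_range.1 hs; omega)
  have hAk : ∀ k ≤ n, ∑ s ∈ Finset.range k, a s ≤ ∑ s ∈ Finset.range n, a s := fun k hk =>
    Finset.sum_le_sum_of_subset_of_nonneg (Finset.range_mono hk) fun s hs _ =>
      ha s (by have := Finset.mem_range.1 hs; omega)
  have hRk : ∀ k ≤ n, ∑ s ∈ Finset.range k, a s ^ 2 ≤ ∑ s ∈ Finset.range n, a s ^ 2 := fun k hk =>
    Finset.sum_le_sum_of_subset_of_nonneg (Finset.range_mono hk) fun s hs _ => sq_nonneg _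
  have hA1 : ∑ s ∈ Finset.range n, a s ≤ ∑ s ∈ Finset.range (n + 1), a s := by
    rw [Finset.sum_range_succ]; linarith [ha n (by omega)]
  have hb := hAk0 n le_rfl
  have hR : 0 ≤ ∑ s ∈ Finset.range n, a s ^ 2 := Finset.sum_nonneg fun s _ => sq_nonneg _
  have hsumA : ∑ k ∈ Finset.range (n + 1), a k = ∑ s ∈ Finset.range (n + 1), a s := rfl
  set A := ∑ s ∈ Finset.range (n + 1), a s
  set b := ∑ s ∈ Finset.range n, a s
  set R := ∑ s ∈ Finset.range n, a s ^ 2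
  have hA0 : 0 ≤ A := hb.trans hA1
  have hbb : b ^ 2 ≤ A * b := by nlinarith
  -- As 32 e l b² ≤ 1, the feedback coefficient 6 e l b² is at most 3/16, so `X` solves X = e (2 v R
  -- + 3 b² N) + 3/16 X.
  set X := 16 / 13 * e * (2 * (v * R) + 3 * b ^ 2 * N) with hX
  have hX0 : 0 ≤ X := by positivity
  have hel : 0 ≤ e * l := by positivity
  have hstep : ∀ k ≤ n, (∀ s < k, W s ≤ X) →
      W k ≤ 2 * e * (v * R) + (3 * e * N + 6 * (e * l) * X) *
        (∑ s ∈ Finset.range k, a s) ^ 2 := by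
    intro k hk hs
    have h1 : ∑ s ∈ Finset.range k, a s * (3 / 2 * N + 3 * l * W s)
        ≤ (∑ s ∈ Finset.range k, a s) * (3 / 2 * N + 3 * l * X) := by
      rw [Finset.sum_mul]
      refine Finset.sum_le_sum fun s hs' => ?_
      have := Finset.mem_range.1 hs'
      have h2 := hs s this
      have h3 := ha s (by omega)
      gcongr
    have h2 := mul_le_mul_of_nonneg_left h1 (hAk0 k hk)
    have h3 := mul_le_mul_of_nonneg_left h2 (by positivity : 0 ≤ 2 * e)
    have h4 := mul_le_mul_of_nonneg_left (mul_le_mul_of_nonneg_left (hRk k hk) hv)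
      (by positivity : 0 ≤ 2 * e)
    have h5 := hW k (by omega)
    nlinarith
  have hWX : ∀ k ≤ n, W k ≤ X := by
    intro k
    induction k using Nat.strong_induction_on with
    | _ k ih =>
      intro hk
      have h1 := hstep k hk fun s hs => ih s hs (by omega)
      have h2 : (∑ s ∈ Finset.range k, a s) ^ 2 ≤ b ^ 2 :=
        pow_le_pow_left₀ (hAk0 k hk) (hAk k hk) 2
      have h3 := mul_le_mul_of_nonneg_left h2
        (by positivity : 0 ≤ 3 * e * N + 6 * (e * l) * X)
      have h4 : 32 * (e * l) * b ^ 2 ≤ 1 := by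
        nlinarith [mul_le_mul_of_nonneg_left hbb hel]
      have h5 := mul_le_mul_of_nonneg_right h4 hX0
      have h6 : 13 * X = 16 * (e * (2 * (v * R) + 3 * b ^ 2 * N)) := by rw [hX]; ring
      nlinarith
  calc ∑ k ∈ Finset.range (n + 1), a k * W k
      ≤ ∑ k ∈ Finset.range (n + 1), (a k * (2 * e * (v * R)) + (3 * e * N + 6 * (e * l) * X) *
          (a k * (∑ s ∈ Finset.range k, a s) ^ 2)) := by
        refine Finset.sum_le_sum fun k hk => ?_
        have hk' := Finset.mem_range.1 hk
        have h1 := hstep k (by omega) fun s hs => hWX s (by omega)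
        have h2 := mul_le_mul_of_nonneg_left h1 (ha k hk')
        linarith
    _ = A * (2 * e * (v * R)) + (3 * e * N + 6 * (e * l) * X) *
          ∑ k ∈ Finset.range (n + 1), a k * (∑ s ∈ Finset.range k, a s) ^ 2 := by
        rw [Finset.sum_add_distrib, ← Finset.sum_mul, ← Finset.mul_sum]
    _ ≤ A * (2 * e * (v * R)) + (3 * e * N + 6 * (e * l) * X) * (3 / 8 * A ^ 2 * b) := by
        gcongr
    _ ≤ _ := by
        -- The feedback term is 9/4 e l (A b) A X ≤ 9/128 A X. The resulting constants are 2 + 9/52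
        -- ≤ 9/4 for the noise and 9/8 + 27/104 ≤ 3/2 for the gradient.
        have h1 : A * X * (32 * e * l * (A * b)) ≤ A * X * 1 := by gcongr
        have h2 : X ≤ 16 / 13 * e * (2 * (v * R) + 3 * (A * b) * N) := by
          rw [hX]; gcongr
        have h3 := mul_le_mul_of_nonneg_left h2 hA0
        have h4 : 0 ≤ A * (e * (v * R)) := by positivity
        have h5 : 0 ≤ A * (e * (A * b) * N) := by positivity
        nlinarith

/-! ### Square integrable random vectors -/

theorem integrable_inner_of_memLp_two {Ω E : Type*} [MeasurableSpace Ω] {P : Measure Ω}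
    [NormedAddCommGroup E] [InnerProductSpace ℝ E] {X Y : Ω → E}
    (hX : MemLp X 2 P) (hY : MemLp Y 2 P) : Integrable (fun o => inner ℝ (X o) (Y o)) P := by
  refine ((hX.integrable_norm_pow two_ne_zero).add (hY.integrable_norm_pow two_ne_zero)).mono'
    (hX.1.inner hY.1) (Filter.Eventually.of_forall fun o => ?_)
  refine (norm_inner_le_norm (𝕜 := ℝ) (X o) (Y o)).trans ?_
  simp only [Pi.add_apply]
  nlinarith [sq_nonneg (‖X o‖ - ‖Y o‖), sq_nonneg ‖X o‖, sq_nonneg ‖Y o‖]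

theorem integral_inner_add_add {Ω E : Type*} [MeasurableSpace Ω] {P : Measure Ω}
    [NormedAddCommGroup E] [InnerProductSpace ℝ E] {X Y U V : Ω → E} (hX : MemLp X 2 P)
    (hY : MemLp Y 2 P) (hU : MemLp U 2 P) (hV : MemLp V 2 P) :
    ∫ o, inner ℝ (X o + Y o) (U o + V o) ∂P = ∫ o, inner ℝ (X o) (U o) ∂P
      + ∫ o, inner ℝ (X o) (V o) ∂P
      + (∫ o, inner ℝ (Y o) (U o) ∂P + ∫ o, inner ℝ (Y o) (V o) ∂P) := by
  have i1 := integrable_inner_of_memLp_two hX hU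
  have i2 := integrable_inner_of_memLp_two hX hV
  have i3 := integrable_inner_of_memLp_two hY hU
  have i4 := integrable_inner_of_memLp_two hY hV
  rw [← integral_add i1 i2, ← integral_add i3 i4]
  refine Eq.trans ?_ (integral_add (i1.add i2) (i3.add i4))
  refine integral_congr_ae (Filter.Eventually.of_forall fun o => ?_)
  simp only [inner_add_left, inner_add_right]
  ring

theorem integral_norm_sum_sq {Ω E ι : Type*} [MeasurableSpace Ω] {P : Measure Ω}
    [NormedAddCommGroup E] [InnerProductSpace ℝ E] (s : Finset ι) {X : ι → Ω → E}
    (hX : ∀ i ∈ s, MemLp (X i) 2 P) :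
    ∫ o, ‖∑ i ∈ s, X i o‖ ^ 2 ∂P = ∑ i ∈ s, ∑ j ∈ s, ∫ o, inner ℝ (X i o) (X j o) ∂P := by
  simp_rw [← real_inner_self_eq_norm_sq, sum_inner, inner_sum]
  rw [integral_finsetSum _ fun i hi => integrable_finsetSum _ fun j hj =>
    integrable_inner_of_memLp_two (hX i hi) (hX j hj)]
  exact Finset.sum_congr rfl fun i hi => integral_finsetSum _ fun j hj =>
    integrable_inner_of_memLp_two (hX i hi) (hX j hj)

theorem integral_norm_sum_sq_of_orthogonal {Ω E ι : Type*} [MeasurableSpace Ω] {P : Measure Ω}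
    [NormedAddCommGroup E] [InnerProductSpace ℝ E] (s : Finset ι) {X : ι → Ω → E}
    (hX : ∀ i ∈ s, MemLp (X i) 2 P)
    (h : ∀ i ∈ s, ∀ j ∈ s, i ≠ j → ∫ o, inner ℝ (X i o) (X j o) ∂P = 0) :
    ∫ o, ‖∑ i ∈ s, X i o‖ ^ 2 ∂P = ∑ i ∈ s, ∫ o, ‖X i o‖ ^ 2 ∂P := by
  classical
  rw [integral_norm_sum_sq s hX]
  refine Finset.sum_congr rfl fun i hi => ?_
  rw [Finset.sum_eq_single_of_mem i hi fun j hj hij => h i hi j hj hij.symm]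
  simp_rw [real_inner_self_eq_norm_sq]

theorem memLp_two_comp_of_lipschitz {Ω : Type*} [MeasurableSpace Ω] {P : Measure Ω}
    [IsFiniteMeasure P] {d : ℕ} {L : ℝ} {F : Param d → ℝ} (h : Smooth L F) {Y : Ω → Param d}
    (hY : MemLp Y 2 P) : MemLp (fun o => gradient F (Y o)) 2 P := by
  have h1 : MemLp (fun o => gradient F (Y o) - gradient F 0) 2 P := by
    refine hY.of_le_mul (c := L) ?_ (Filter.Eventually.of_forall fun o => ?_)
    · exact ((h.measurable_gradient.comp_aemeasurable hY.1.aemeasurable).sub_const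
        _).aestronglyMeasurable
    · simpa using h.2 (Y o) 0
  simpa only [Pi.add_def, sub_add_cancel] using h1.add (memLp_const (gradient F 0))

/-! ### Independence of the inputs -/

/-- The σ-algebras generated by the single inputs: the outcome of the sampling in round `t`, or one
batch. -/
abbrev inputAlgebra {Ω 𝒮 Z ι : Type*} [MeasurableSpace 𝒮] [MeasurableSpace Z] (S : ℕ → Ω → 𝒮)
    (ξ : ι → Ω → Z) : ℕ ⊕ ι → MeasurableSpace Ω :=
  Sum.elim (fun t => MeasurableSpace.comap (S t) inferInstance)
    fun j => MeasurableSpace.comap (ξ j) inferInstance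

/-- A finite intersection splits into a sampling part and a batch part; these are independent of
each other, and each factorises by itself. Having one independent family makes every single input
independent of all the others together. -/
theorem iIndep_inputAlgebra {Ω 𝒮 Z ι : Type*} [MeasurableSpace Ω] [MeasurableSpace 𝒮]
    [MeasurableSpace Z] {P : Measure Ω} {S : ℕ → Ω → 𝒮} {ξ : ι → Ω → Z} (hS : iIndepFun S P)
    (hξ : iIndepFun ξ P) (h : IndepFun (fun o t => S t o) (fun o j => ξ j o) P) :
    iIndep (inputAlgebra S ξ) P := by
  rw [iIndep_iff]
  intro s f hf
  have hL : ∀ t ∈ s.toLeft, MeasurableSet[MeasurableSpace.comap (S t) inferInstance]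
      (f (Sum.inl t)) := fun t ht => hf _ (Finset.mem_toLeft.1 ht)
  have hR : ∀ j ∈ s.toRight, MeasurableSet[MeasurableSpace.comap (ξ j) inferInstance]
      (f (Sum.inr j)) := fun j hj => hf _ (Finset.mem_toRight.1 hj)
  have hsplit : (⋂ i ∈ s, f i)
      = (⋂ t ∈ s.toLeft, f (Sum.inl t)) ∩ ⋂ j ∈ s.toRight, f (Sum.inr j) := by
    ext o
    simp [Sum.forall]
  have hleS : ∀ t, MeasurableSpace.comap (S t) inferInstance
      ≤ MeasurableSpace.comap (fun o t => S t o) (inferInstance : MeasurableSpace (ℕ → 𝒮)) := by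
    rintro t _ ⟨B, hB, rfl⟩
    exact ⟨_, measurable_pi_apply t hB, rfl⟩
  have hleξ : ∀ j, MeasurableSpace.comap (ξ j) inferInstance
      ≤ MeasurableSpace.comap (fun o j => ξ j o) (inferInstance : MeasurableSpace (ι → Z)) := by
    rintro j _ ⟨B, hB, rfl⟩
    exact ⟨_, measurable_pi_apply j hB, rfl⟩
  rw [hsplit, (Indep_iff _ _ _).1 ((IndepFun_iff_Indep _ _ _).1 h) _ _
      (Finset.measurableSet_biInter _ fun t ht => hleS t _ (hL t ht))
      (Finset.measurableSet_biInter _ fun j hj => hleξ j _ (hR j hj)),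
    hS.iIndep.meas_biInter hL, hξ.iIndep.meas_biInter hR]
  conv_rhs => rw [← Finset.toLeft_disjSum_toRight (u := s), Finset.prod_disjSum]

/-- What is measurable for all inputs but one is independent of that input. -/
theorem indep_biSup_compl_singleton {Ω ι : Type*} [mΩ : MeasurableSpace Ω] {P : Measure Ω}
    {m : ι → MeasurableSpace Ω} (hle : ∀ i, m i ≤ mΩ) (hm : iIndep m P) (i : ι) :
    Indep (⨆ j ∈ ({i}ᶜ : Set ι), m j) (m i) P := by
  have h := indep_iSup_of_disjoint (S := ({i}ᶜ : Set ι)) (T := {i}) hle hm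
    (Set.disjoint_singleton_right.2 (by simp))
  simpa using h

theorem indepFun_of_indep {Ω β γ : Type*} {m₁ _m0 : MeasurableSpace Ω} {P : Measure Ω}
    [MeasurableSpace β] [MeasurableSpace γ] {X : Ω → β} {Y : Ω → γ} (hX : Measurable[m₁] X)
    (h : Indep m₁ (MeasurableSpace.comap Y inferInstance) P) : IndepFun X Y P :=
  (IndepFun_iff_Indep _ _ _).2 (indep_of_indep_of_le_left h hX.comap_le)

/-! ### The gradient noise -/

section Noise

variable {Ω Z : Type*} [MeasurableSpace Ω] [MeasurableSpace Z] {P : Measure Ω}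
  [IsProbabilityMeasure P] {d : ℕ} {D : Measure Z} {L σ : ℝ} {f : Param d → ℝ}
  {g : Param d → Z → Param d}

theorem StochasticGradient.measurable_noise (hg : StochasticGradient D σ f g) (hf : Smooth L f) :
    Measurable fun q : Param d × Z => g q.1 q.2 - gradient f q.1 :=
  hg.measurable.sub (hf.measurable_gradient.comp measurable_fst)

theorem StochasticGradient.noise_memLp [IsProbabilityMeasure D] (hg : StochasticGradient D σ f g)
    (x : Param d) : MemLp (fun z => g x z - gradient f x) 2 D :=
  (hg.memLp x).sub (memLp_const _)

/-- By Tonelli on the product law, the variance bound applies at each frozen point. Lower integrals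
are used because integrability of the noise at a random point is not yet known; it is deduced from
this bound. -/
theorem StochasticGradient.lintegral_noise_le (hg : StochasticGradient D σ f g) (hf : Smooth L f)
    {Y : Ω → Param d} {ζ : Ω → Z} (hY : Measurable Y) (hζ : Measurable ζ) (hlaw : P.map ζ = D)
    (hind : IndepFun Y ζ P) :
    ∫⁻ o, ENNReal.ofReal (‖g (Y o) (ζ o) - gradient f (Y o)‖ ^ 2) ∂P ≤ ENNReal.ofReal (σ ^ 2) := by
  have hm : Measurable fun q : Param d × Z =>
      ENNReal.ofReal (‖g q.1 q.2 - gradient f q.1‖ ^ 2) :=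
    ((hg.measurable_noise hf).norm.pow_const 2).ennreal_ofReal
  have hD : IsProbabilityMeasure D := hlaw ▸ Measure.isProbabilityMeasure_map hζ.aemeasurable
  have hYP : IsProbabilityMeasure (P.map Y) := Measure.isProbabilityMeasure_map hY.aemeasurable
  calc ∫⁻ o, ENNReal.ofReal (‖g (Y o) (ζ o) - gradient f (Y o)‖ ^ 2) ∂P
      = ∫⁻ q, ENNReal.ofReal (‖g q.1 q.2 - gradient f q.1‖ ^ 2) ∂(P.map fun o => (Y o, ζ o)) := by
        rw [lintegral_map hm (hY.prodMk hζ)]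
    _ = ∫⁻ y, ∫⁻ z, ENNReal.ofReal (‖g y z - gradient f y‖ ^ 2) ∂D ∂(P.map Y) := by
        rw [hind.map_prod_eq_prod_map_map hY.aemeasurable hζ.aemeasurable, hlaw,
          lintegral_prod _ hm.aemeasurable]
    _ ≤ ∫⁻ _, ENNReal.ofReal (σ ^ 2) ∂(P.map Y) := by
        refine lintegral_mono fun y => ?_
        rw [← ofReal_integral_eq_lintegral_ofReal
          ((hg.noise_memLp y).integrable_norm_pow two_ne_zero)
          (Filter.Eventually.of_forall fun z => sq_nonneg _)]
        exact ENNReal.ofReal_le_ofReal (hg.variance_le y)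
    _ = ENNReal.ofReal (σ ^ 2) := by simp

theorem StochasticGradient.memLp_noise_comp (hg : StochasticGradient D σ f g) (hf : Smooth L f)
    {Y : Ω → Param d} {ζ : Ω → Z} (hY : Measurable Y) (hζ : Measurable ζ) (hlaw : P.map ζ = D)
    (hind : IndepFun Y ζ P) : MemLp (fun o => g (Y o) (ζ o) - gradient f (Y o)) 2 P := by
  have hm : Measurable fun o => g (Y o) (ζ o) - gradient f (Y o) :=
    (hg.measurable_noise hf).comp (hY.prodMk hζ)
  rw [memLp_two_iff_integrable_sq_norm hm.aestronglyMeasurable]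
  refine ⟨(hm.norm.pow_const 2).aestronglyMeasurable, ?_⟩
  rw [hasFiniteIntegral_iff_ofReal (Filter.Eventually.of_forall fun o => sq_nonneg _)]
  exact (hg.lintegral_noise_le hf hY hζ hlaw hind).trans_lt ENNReal.ofReal_lt_top

theorem StochasticGradient.integral_noise_sq_le (hg : StochasticGradient D σ f g)
    (hf : Smooth L f) {Y : Ω → Param d} {ζ : Ω → Z} (hY : Measurable Y) (hζ : Measurable ζ)
    (hlaw : P.map ζ = D) (hind : IndepFun Y ζ P) :
    ∫ o, ‖g (Y o) (ζ o) - gradient f (Y o)‖ ^ 2 ∂P ≤ σ ^ 2 := by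
  rw [← ENNReal.ofReal_le_ofReal_iff (sq_nonneg σ), ofReal_integral_eq_lintegral_ofReal
    ((hg.memLp_noise_comp hf hY hζ hlaw hind).integrable_norm_pow two_ne_zero)
    (Filter.Eventually.of_forall fun o => sq_nonneg _)]
  exact hg.lintegral_noise_le hf hY hζ hlaw hind

/-- Independence of ζ from the pair (Y, V) freezes both, and the inner integral vanishes by
unbiasedness. This plays the role of conditioning on the past. -/
theorem StochasticGradient.integral_inner_noise (hg : StochasticGradient D σ f g)
    (hf : Smooth L f) {Y V : Ω → Param d} {ζ : Ω → Z} (hY : Measurable Y) (hV : Measurable V)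
    (hζ : Measurable ζ) (hlaw : P.map ζ = D) (hind : IndepFun (fun o => (Y o, V o)) ζ P)
    (hV2 : MemLp V 2 P) :
    ∫ o, inner ℝ (V o) (g (Y o) (ζ o) - gradient f (Y o)) ∂P = 0 := by
  have hm : Measurable fun q : (Param d × Param d) × Z =>
      inner ℝ q.1.2 (g q.1.1 q.2 - gradient f q.1.1) :=
    (measurable_snd.comp measurable_fst).inner ((hg.measurable_noise hf).comp
      ((measurable_fst.comp measurable_fst).prodMk measurable_snd))
  have hD : IsProbabilityMeasure D := hlaw ▸ Measure.isProbabilityMeasure_map hζ.aemeasurable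
  have hYV : Measurable fun o => (Y o, V o) := hY.prodMk hV
  have hPP : IsProbabilityMeasure (P.map fun o => (Y o, V o)) :=
    Measure.isProbabilityMeasure_map hYV.aemeasurable
  have hn := hg.memLp_noise_comp hf hY hζ hlaw (hind.comp measurable_fst measurable_id)
  have hint := integrable_inner_of_memLp_two hV2 hn
  have hmap : P.map (fun o => ((Y o, V o), ζ o)) = (P.map fun o => (Y o, V o)).prod D := by
    rw [hind.map_prod_eq_prod_map_map hYV.aemeasurable hζ.aemeasurable, hlaw]
  have hint' : Integrable (fun q : (Param d × Param d) × Z =>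
      inner ℝ q.1.2 (g q.1.1 q.2 - gradient f q.1.1)) ((P.map fun o => (Y o, V o)).prod D) := by
    rw [← hmap, integrable_map_measure hm.aestronglyMeasurable (hYV.prodMk hζ).aemeasurable]
    exact hint
  calc ∫ o, inner ℝ (V o) (g (Y o) (ζ o) - gradient f (Y o)) ∂P
      = ∫ q, inner ℝ q.1.2 (g q.1.1 q.2 - gradient f q.1.1)
          ∂(P.map (fun o => ((Y o, V o), ζ o))) := by
        rw [integral_map (hYV.prodMk hζ).aemeasurable hm.aestronglyMeasurable]
    _ = ∫ y, ∫ z, inner ℝ y.2 (g y.1 z - gradient f y.1) ∂D ∂(P.map fun o => (Y o, V o)) := by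
        rw [hmap, integral_prod _ hint']
    _ = 0 := by
        have : ∀ y : Param d × Param d, ∫ z, inner ℝ y.2 (g y.1 z - gradient f y.1) ∂D = 0 := by
          intro y
          rw [integral_inner ((hg.noise_memLp y.1).integrable one_le_two),
            integral_sub ((hg.memLp y.1).integrable one_le_two) (integrable_const _),
            hg.unbiased y.1]
          simp
        simp [this]

end Noise

/-! ### Young-type inequalities for squared norms -/

theorem norm_add_sq_le_two {E : Type*} [SeminormedAddCommGroup E] (u v : E) :
    ‖u + v‖ ^ 2 ≤ 2 * ‖u‖ ^ 2 + 2 * ‖v‖ ^ 2 := by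
  have h := pow_le_pow_left₀ (norm_nonneg _) (norm_add_le u v) 2
  nlinarith [sq_nonneg (‖u‖ - ‖v‖)]

/-- From 2‖u‖‖v‖ ≤ ‖u‖²/2 + 2‖v‖². The light weight goes to the gradient at the starting point, the
heavy one to the drift, which carries a small factor. -/
theorem norm_add_sq_le_three {E : Type*} [SeminormedAddCommGroup E] (u v : E) :
    ‖u + v‖ ^ 2 ≤ 3 / 2 * ‖u‖ ^ 2 + 3 * ‖v‖ ^ 2 := by
  have h := pow_le_pow_left₀ (norm_nonneg _) (norm_add_le u v) 2
  nlinarith [sq_nonneg (‖u‖ - 2 * ‖v‖)]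

/-! ### The local work of one client, from a random starting point -/

theorem measurable_localModel {Ω Z : Type*} [MeasurableSpace Ω] [MeasurableSpace Z] {d : ℕ}
    (ηl : ℝ) (c : ℕ → ℕ → ℝ) {g : Param d → Z → Param d}
    (hg : Measurable fun q : Param d × Z => g q.1 q.2) {θ : Ω → Param d} (hθ : Measurable θ)
    {ζ : ℕ → Ω → Z} (k : ℕ) (hζ : ∀ s < k, Measurable (ζ s)) :
    Measurable fun o => localModel ηl c g (fun s => ζ s o) (θ o) k := by
  induction k using Nat.strong_induction_on with
  | _ k ih =>
    have h : (fun o => localModel ηl c g (fun s => ζ s o) (θ o) k) = fun o => θ o - ηl •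
        ∑ s : Fin k, c k s • g (localModel ηl c g (fun s => ζ s o) (θ o) s) (ζ s o) := by
      funext o
      rw [localModel]
    rw [h]
    refine hθ.sub (Measurable.const_smul (Finset.measurable_fun_sum _ fun s _ => ?_) ηl)
    exact (hg.comp ((ih s s.isLt fun r hr => hζ r (hr.trans s.isLt)).prodMk
      (hζ s s.isLt))).const_smul (c k s)

/-- The local models of a client, as random variables. -/
noncomputable def clientModel {Ω Z : Type*} {d : ℕ} (ηl : ℝ) (c : ℕ → ℕ → ℝ) (g : Param d → Z → Param d)
    (θ : Ω → Param d) (ζ : ℕ → Ω → Z) (k : ℕ) (o : Ω) : Param d :=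
  localModel ηl c g (fun s => ζ s o) (θ o) k

/-- The noise of the stochastic gradient at a local step. -/
noncomputable def clientNoise {Ω Z : Type*} {d : ℕ} (ηl : ℝ) (c : ℕ → ℕ → ℝ) (f : Param d → ℝ)
    (g : Param d → Z → Param d) (θ : Ω → Param d) (ζ : ℕ → Ω → Z) (k : ℕ) (o : Ω) : Param d :=
  g (clientModel ηl c g θ ζ k o) (ζ k o) - gradient f (clientModel ηl c g θ ζ k o)

/-- The change of the gradient between the starting point and a local model. -/
noncomputable def clientDev {Ω Z : Type*} {d : ℕ} (ηl : ℝ) (c : ℕ → ℕ → ℝ) (f : Param d → ℝ)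
    (g : Param d → Z → Param d) (θ : Ω → Param d) (ζ : ℕ → Ω → Z) (k : ℕ) (o : Ω) : Param d :=
  gradient f (clientModel ηl c g θ ζ k o) - gradient f (θ o)

theorem clientModel_eq {Ω Z : Type*} {d : ℕ} (ηl : ℝ) (c : ℕ → ℕ → ℝ) (f : Param d → ℝ)
    (g : Param d → Z → Param d) (θ : Ω → Param d) (ζ : ℕ → Ω → Z) (k : ℕ) (o : Ω) :
    clientModel ηl c g θ ζ k o = θ o - ηl • (∑ s ∈ Finset.range k, c k s •
      clientNoise ηl c f g θ ζ s o + ∑ s ∈ Finset.range k, c k s •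
        gradient f (clientModel ηl c g θ ζ s o)) := by
  rw [← Finset.sum_add_distrib]
  simp_rw [← smul_add, clientNoise, sub_add_cancel]
  rw [clientModel, localModel, Fin.sum_univ_eq_sum_range (fun s =>
    c k s • g (localModel ηl c g (fun s => ζ s o) (θ o) s) (ζ s o)) k]
  rfl

/-- The batches `ζ 0, ζ 1, …` of one client have law `D`, and `ζ k` is independent of the
information `𝒢 k`, which includes the starting point and the earlier batches. -/
structure ClientInputs {Ω Z : Type*} [mΩ : MeasurableSpace Ω] [MeasurableSpace Z] {d : ℕ}
    (P : Measure Ω) (D : Measure Z) (𝒢 : ℕ → MeasurableSpace Ω) (θ : Ω → Param d)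
    (ζ : ℕ → Ω → Z) : Prop where
  le : ∀ k, 𝒢 k ≤ mΩ
  measurable_start : ∀ k, Measurable[𝒢 k] θ
  measurable_past : ∀ k, ∀ s < k, Measurable[𝒢 k] (ζ s)
  measurable : ∀ k, Measurable (ζ k)
  law : ∀ k, P.map (ζ k) = D
  indep : ∀ k, Indep (𝒢 k) (MeasurableSpace.comap (ζ k) inferInstance) P
  memLp : MemLp θ 2 P

namespace ClientInputs

variable {Ω Z : Type*} [mΩ : MeasurableSpace Ω] [MeasurableSpace Z] {d : ℕ} {P : Measure Ω}
  {D : Measure Z} {𝒢 : ℕ → MeasurableSpace Ω} {θ : Ω → Param d} {ζ : ℕ → Ω → Z} {L σ ηl : ℝ}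
  {c : ℕ → ℕ → ℝ} {f : Param d → ℝ} {g : Param d → Z → Param d}

theorem measurable_model_info (h : ClientInputs P D 𝒢 θ ζ) (hg : StochasticGradient D σ f g)
    {s k : ℕ} (hsk : s ≤ k) : Measurable[𝒢 k] (clientModel ηl c g θ ζ s) :=
  @measurable_localModel Ω Z (𝒢 k) _ d ηl c g hg.measurable θ (h.measurable_start k) ζ s
    fun r hr => h.measurable_past k r (hr.trans_le hsk)

theorem measurable_model (h : ClientInputs P D 𝒢 θ ζ) (hg : StochasticGradient D σ f g) (k : ℕ) :
    Measurable (clientModel ηl c g θ ζ k) :=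
  (h.measurable_model_info hg le_rfl).mono (h.le k) le_rfl

theorem measurable_noise_info (h : ClientInputs P D 𝒢 θ ζ) (hg : StochasticGradient D σ f g)
    (hf : Smooth L f) {s k : ℕ} (hsk : s < k) :
    Measurable[𝒢 k] (clientNoise ηl c f g θ ζ s) :=
  (hg.measurable_noise hf).comp
    ((h.measurable_model_info hg hsk.le).prodMk (h.measurable_past k s hsk))

theorem memLp_noise [IsProbabilityMeasure P] (h : ClientInputs P D 𝒢 θ ζ)
    (hg : StochasticGradient D σ f g) (hf : Smooth L f) (k : ℕ) :
    MemLp (clientNoise ηl c f g θ ζ k) 2 P :=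
  hg.memLp_noise_comp hf (h.measurable_model hg k) (h.measurable k) (h.law k)
    (indepFun_of_indep (h.measurable_model_info hg le_rfl) (h.indep k))

theorem integral_noise_sq_le [IsProbabilityMeasure P] (h : ClientInputs P D 𝒢 θ ζ)
    (hg : StochasticGradient D σ f g) (hf : Smooth L f) (k : ℕ) :
    ∫ o, ‖clientNoise ηl c f g θ ζ k o‖ ^ 2 ∂P ≤ σ ^ 2 :=
  hg.integral_noise_sq_le hf (h.measurable_model hg k) (h.measurable k) (h.law k)
    (indepFun_of_indep (h.measurable_model_info hg le_rfl) (h.indep k))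

theorem integral_inner_noise [IsProbabilityMeasure P] (h : ClientInputs P D 𝒢 θ ζ)
    (hg : StochasticGradient D σ f g) (hf : Smooth L f) {k : ℕ} {V : Ω → Param d}
    (hV : Measurable[𝒢 k] V) (hV2 : MemLp V 2 P) :
    ∫ o, inner ℝ (V o) (clientNoise ηl c f g θ ζ k o) ∂P = 0 :=
  hg.integral_inner_noise hf (h.measurable_model hg k) (hV.mono (h.le k) le_rfl) (h.measurable k)
    (h.law k)
    (indepFun_of_indep ((h.measurable_model_info hg le_rfl).prodMk hV) (h.indep k)) hV2

/-- The noise at the earlier step is a function of the starting point and of batches preceding the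
later one, so this is the orthogonality of martingale differences. -/
theorem integral_inner_noise_noise [IsProbabilityMeasure P] (h : ClientInputs P D 𝒢 θ ζ)
    (hg : StochasticGradient D σ f g) (hf : Smooth L f) {s k : ℕ} (hsk : s ≠ k) :
    ∫ o, inner ℝ (clientNoise ηl c f g θ ζ s o) (clientNoise ηl c f g θ ζ k o) ∂P = 0 := by
  rcases hsk.lt_or_gt with hsk | hsk
  · exact h.integral_inner_noise hg hf (h.measurable_noise_info hg hf hsk) (h.memLp_noise hg hf s)
  · simp_rw [real_inner_comm (clientNoise ηl c f g θ ζ k _)]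
    exact h.integral_inner_noise hg hf (h.measurable_noise_info hg hf hsk) (h.memLp_noise hg hf k)

theorem memLp_model [IsProbabilityMeasure P] (h : ClientInputs P D 𝒢 θ ζ)
    (hg : StochasticGradient D σ f g) (hf : Smooth L f) (k : ℕ) :
    MemLp (clientModel ηl c g θ ζ k) 2 P := by
  induction k using Nat.strong_induction_on with
  | _ k ih =>
    have h1 : MemLp (fun o => ∑ s ∈ Finset.range k, c k s • clientNoise ηl c f g θ ζ s o) 2 P :=
      memLp_finsetSum _ fun s _ =>
    (h.memLp_noise (ηl := ηl) (c := c) hg hf s).const_smul (c k s)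
    have h2 : MemLp (fun o => ∑ s ∈ Finset.range k, c k s •
        gradient f (clientModel ηl c g θ ζ s o)) 2 P :=
      memLp_finsetSum _ fun s hs =>
        (memLp_two_comp_of_lipschitz hf (ih s (Finset.mem_range.1 hs))).const_smul (c k s)
    have h3 := h.memLp.sub ((h1.add h2).const_smul ηl)
    refine h3.congr_norm (h.measurable_model hg k).aestronglyMeasurable
      (Filter.Eventually.of_forall fun o => ?_)
    rw [clientModel_eq ηl c f g θ ζ k o]
    rfl

theorem memLp_dev [IsProbabilityMeasure P] (h : ClientInputs P D 𝒢 θ ζ)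
    (hg : StochasticGradient D σ f g) (hf : Smooth L f) (k : ℕ) :
    MemLp (clientDev ηl c f g θ ζ k) 2 P :=
  (memLp_two_comp_of_lipschitz hf (h.memLp_model hg hf k)).sub
    (memLp_two_comp_of_lipschitz hf h.memLp)

theorem integrable_drift [IsProbabilityMeasure P] (h : ClientInputs P D 𝒢 θ ζ)
    (hg : StochasticGradient D σ f g) (hf : Smooth L f) (k : ℕ) :
    Integrable (fun o => ‖clientModel ηl c g θ ζ k o - θ o‖ ^ 2) P :=
  ((h.memLp_model hg hf k).sub h.memLp).integrable_norm_pow two_ne_zero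

theorem integrable_gradient_sq [IsProbabilityMeasure P] (h : ClientInputs P D 𝒢 θ ζ)
    (hf : Smooth L f) : Integrable (fun o => ‖gradient f (θ o)‖ ^ 2) P :=
  (memLp_two_comp_of_lipschitz hf h.memLp).integrable_norm_pow two_ne_zero

theorem integral_sum_noise_sq_le [IsProbabilityMeasure P] (h : ClientInputs P D 𝒢 θ ζ)
    (hg : StochasticGradient D σ f g) (hf : Smooth L f) (w : ℕ → ℝ) (n : ℕ) :
    ∫ o, ‖∑ s ∈ Finset.range n, w s • clientNoise ηl c f g θ ζ s o‖ ^ 2 ∂P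
      ≤ σ ^ 2 * ∑ s ∈ Finset.range n, w s ^ 2 := by
  rw [integral_norm_sum_sq_of_orthogonal (X := fun s o => w s • clientNoise ηl c f g θ ζ s o) _
    (fun s _ => (h.memLp_noise hg hf s).const_smul (w s)), Finset.mul_sum]
  · refine Finset.sum_le_sum fun s _ => ?_
    simp_rw [norm_smul, mul_pow, Real.norm_eq_abs, sq_abs]
    rw [integral_const_mul, mul_comm]
    exact mul_le_mul_of_nonneg_right (h.integral_noise_sq_le hg hf s) (sq_nonneg _)
  · intro s _ k _ hsk
    simp_rw [real_inner_smul_left, real_inner_smul_right]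
    rw [integral_const_mul, integral_const_mul, h.integral_inner_noise_noise hg hf hsk, mul_zero,
      mul_zero]

/-- The displacement is a noise sum plus a sum of exact gradients. Orthogonality makes the first
cost only ∑ a_s², Jensen handles the second, and each gradient is compared with the one at θ. This
is the recursion solved by `sum_drift_le`. -/
theorem integral_drift_le [IsProbabilityMeasure P] (h : ClientInputs P D 𝒢 θ ζ)
    (hg : StochasticGradient D σ f g) (hf : Smooth L f) {a : ℕ → ℝ} {k : ℕ}
    (hc : ∀ s < k, 0 ≤ c k s ∧ c k s ≤ a s) :
    ∫ o, ‖clientModel ηl c g θ ζ k o - θ o‖ ^ 2 ∂P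
      ≤ 2 * ηl ^ 2 * (σ ^ 2 * ∑ s ∈ Finset.range k, a s ^ 2)
        + 2 * ηl ^ 2 * ((∑ s ∈ Finset.range k, a s) * ∑ s ∈ Finset.range k, a s *
          (3 / 2 * (∫ o, ‖gradient f (θ o)‖ ^ 2 ∂P)
            + 3 * L ^ 2 * ∫ o, ‖clientModel ηl c g θ ζ s o - θ o‖ ^ 2 ∂P)) := by
  set X : Ω → Param d := fun o => ∑ s ∈ Finset.range k, c k s • clientNoise ηl c f g θ ζ s o
  have ha : ∀ s ∈ Finset.range k, 0 ≤ a s := fun s hs =>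
    (hc s (Finset.mem_range.1 hs)).1.trans (hc s (Finset.mem_range.1 hs)).2
  have hX : MemLp X 2 P := memLp_finsetSum _ fun s _ =>
    (h.memLp_noise (ηl := ηl) (c := c) hg hf s).const_smul (c k s)
  have hXsq : ∫ o, ‖X o‖ ^ 2 ∂P ≤ σ ^ 2 * ∑ s ∈ Finset.range k, a s ^ 2 := by
    refine (h.integral_sum_noise_sq_le hg hf (c k) k).trans ?_
    refine mul_le_mul_of_nonneg_left (Finset.sum_le_sum fun s hs => ?_) (sq_nonneg _)
    have := hc s (Finset.mem_range.1 hs)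
    exact pow_le_pow_left₀ this.1 this.2 2
  have hpt : ∀ o, ‖clientModel ηl c g θ ζ k o - θ o‖ ^ 2 ≤ 2 * ηl ^ 2 * ‖X o‖ ^ 2
      + 2 * ηl ^ 2 * ((∑ s ∈ Finset.range k, a s) * ∑ s ∈ Finset.range k, a s *
        (3 / 2 * ‖gradient f (θ o)‖ ^ 2 + 3 * L ^ 2 * ‖clientModel ηl c g θ ζ s o - θ o‖ ^ 2)) := by
    intro o
    have h1 : ‖clientModel ηl c g θ ζ k o - θ o‖ ^ 2 = ηl ^ 2 * ‖X o + ∑ s ∈ Finset.range k,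
        c k s • gradient f (clientModel ηl c g θ ζ s o)‖ ^ 2 := by
      rw [clientModel_eq ηl c f g θ ζ k o, sub_sub_cancel_left, norm_neg, norm_smul, mul_pow,
        Real.norm_eq_abs, sq_abs]
    have h2 := norm_sum_smul_sq_le (Finset.range k) (c k)
      (fun s hs => (hc s (Finset.mem_range.1 hs)).1)
      fun s => gradient f (clientModel ηl c g θ ζ s o)
    have h3 : (∑ s ∈ Finset.range k, c k s) * ∑ s ∈ Finset.range k, c k s *
        ‖gradient f (clientModel ηl c g θ ζ s o)‖ ^ 2 ≤ (∑ s ∈ Finset.range k, a s) *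
        ∑ s ∈ Finset.range k, a s * (3 / 2 * ‖gradient f (θ o)‖ ^ 2
          + 3 * L ^ 2 * ‖clientModel ηl c g θ ζ s o - θ o‖ ^ 2) := by
      refine mul_le_mul (Finset.sum_le_sum fun s hs => (hc s (Finset.mem_range.1 hs)).2)
        (Finset.sum_le_sum fun s hs => ?_)
        (Finset.sum_nonneg fun s hs => mul_nonneg (hc s (Finset.mem_range.1 hs)).1 (sq_nonneg _))
        (Finset.sum_nonneg ha)
      refine mul_le_mul (hc s (Finset.mem_range.1 hs)).2 ?_ (sq_nonneg _) (ha s hs)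
      have h4 := norm_add_sq_le_three (gradient f (θ o))
        (gradient f (clientModel ηl c g θ ζ s o) - gradient f (θ o))
      rw [add_sub_cancel] at h4
      have h5 := pow_le_pow_left₀ (norm_nonneg _) (hf.2 (clientModel ηl c g θ ζ s o) (θ o)) 2
      rw [mul_pow] at h5
      linarith
    have h6 := norm_add_sq_le_two (X o)
      (∑ s ∈ Finset.range k, c k s • gradient f (clientModel ηl c g θ ζ s o))
    rw [h1]
    nlinarith [mul_le_mul_of_nonneg_left (h2.trans h3) (sq_nonneg ηl),
      mul_le_mul_of_nonneg_left h6 (sq_nonneg ηl)]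
  have hi1 : ∀ s, Integrable (fun o => a s * (3 / 2 * ‖gradient f (θ o)‖ ^ 2
      + 3 * L ^ 2 * ‖clientModel ηl c g θ ζ s o - θ o‖ ^ 2)) P := fun s =>
    (((h.integrable_gradient_sq hf).const_mul _).add
      ((h.integrable_drift hg hf s).const_mul _)).const_mul _
  have hi2 : Integrable (fun o => 2 * ηl ^ 2 * ‖X o‖ ^ 2) P :=
    (hX.integrable_norm_pow two_ne_zero).const_mul _
  have hi3 : Integrable (fun o => 2 * ηl ^ 2 * ((∑ s ∈ Finset.range k, a s) *
      ∑ s ∈ Finset.range k, a s * (3 / 2 * ‖gradient f (θ o)‖ ^ 2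
        + 3 * L ^ 2 * ‖clientModel ηl c g θ ζ s o - θ o‖ ^ 2))) P :=
    ((integrable_finsetSum _ fun s _ => hi1 s).const_mul _).const_mul _
  refine (integral_mono (h.integrable_drift hg hf k) (hi2.add hi3) hpt).trans ?_
  simp only [Pi.add_apply]
  rw [integral_add hi2 hi3, integral_const_mul, integral_const_mul, integral_const_mul,
    integral_finsetSum _ fun s _ => hi1 s]
  refine add_le_add (mul_le_mul_of_nonneg_left hXsq (by positivity)) (le_of_eq ?_)
  congr 2
  refine Finset.sum_congr rfl fun s _ => ?_
  rw [integral_const_mul, integral_add ((h.integrable_gradient_sq hf).const_mul _)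
    ((h.integrable_drift hg hf s).const_mul _), integral_const_mul, integral_const_mul]

theorem sum_integral_drift_le [IsProbabilityMeasure P] (h : ClientInputs P D 𝒢 θ ζ)
    (hg : StochasticGradient D σ f g) (hf : Smooth L f) {a : ℕ → ℝ} {n : ℕ}
    (ha : ∀ k < n + 1, 0 ≤ a k)
    (hc : ∀ k < n + 1, ∀ s < k, 0 ≤ c k s ∧ c k s ≤ a s)
    (hsmall : 32 * ηl ^ 2 * L ^ 2 *
      ((∑ s ∈ Finset.range (n + 1), a s) * ∑ s ∈ Finset.range n, a s) ≤ 1) :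
    ∑ k ∈ Finset.range (n + 1), a k * ∫ o, ‖clientModel ηl c g θ ζ k o - θ o‖ ^ 2 ∂P
      ≤ (∑ s ∈ Finset.range (n + 1), a s) *
        (9 / 4 * ηl ^ 2 * (σ ^ 2 * ∑ s ∈ Finset.range n, a s ^ 2) + 3 / 2 * ηl ^ 2 *
          ((∑ s ∈ Finset.range (n + 1), a s) * ∑ s ∈ Finset.range n, a s) *
            ∫ o, ‖gradient f (θ o)‖ ^ 2 ∂P) :=
  sum_drift_le ha (sq_nonneg _) (sq_nonneg _) (sq_nonneg _)
    (integral_nonneg fun _ => sq_nonneg _) hsmall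
    fun k hk => h.integral_drift_le hg hf (hc k hk)

theorem integral_sum_dev_sq_le [IsProbabilityMeasure P] (h : ClientInputs P D 𝒢 θ ζ)
    (hg : StochasticGradient D σ f g) (hf : Smooth L f) {a : ℕ → ℝ} {n : ℕ}
    (ha : ∀ k < n, 0 ≤ a k) :
    ∫ o, ‖∑ k ∈ Finset.range n, a k • clientDev ηl c f g θ ζ k o‖ ^ 2 ∂P
      ≤ (∑ s ∈ Finset.range n, a s) * (L ^ 2 *
        ∑ k ∈ Finset.range n, a k * ∫ o, ‖clientModel ηl c g θ ζ k o - θ o‖ ^ 2 ∂P) := by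
  have hi : ∀ k, Integrable (fun o => a k * ‖clientModel ηl c g θ ζ k o - θ o‖ ^ 2) P :=
    fun k => (h.integrable_drift hg hf k).const_mul _
  have hV : MemLp (fun o => ∑ k ∈ Finset.range n, a k • clientDev ηl c f g θ ζ k o) 2 P :=
    memLp_finsetSum _ fun k _ =>
    (h.memLp_dev (ηl := ηl) (c := c) hg hf k).const_smul (a k)
  simp_rw [← integral_const_mul (a _)]
  rw [← integral_finsetSum _ fun k _ => hi k, ← integral_const_mul, ← integral_const_mul]
  refine integral_mono (hV.integrable_norm_pow two_ne_zero)
    (((integrable_finsetSum _ fun k _ => hi k).const_mul _).const_mul _) fun o => ?_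
  have ha' : ∀ k ∈ Finset.range n, 0 ≤ a k := fun k hk => ha k (Finset.mem_range.1 hk)
  refine (norm_sum_smul_sq_le (Finset.range n) a ha' _).trans
    (mul_le_mul_of_nonneg_left ?_ (Finset.sum_nonneg ha'))
  rw [Finset.mul_sum]
  refine Finset.sum_le_sum fun k hk => ?_
  have h5 := pow_le_pow_left₀ (norm_nonneg _) (hf.2 (clientModel ηl c g θ ζ k o) (θ o)) 2
  rw [mul_pow] at h5
  have h6 := mul_le_mul_of_nonneg_left h5 (ha' k hk)
  rw [clientDev]
  linarith

end ClientInputs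

/-! ### The accumulated stochastic gradient of one client -/

section Defs

variable {Ω Z : Type*} {d : ℕ} (ηl : ℝ) (K : ℕ) (a : ℕ → ℝ) (c : ℕ → ℕ → ℝ) (f : Param d → ℝ)
  (g : Param d → Z → Param d) (θ : Ω → Param d) (ζ : ℕ → Ω → Z) (o : Ω)

/-- The weighted sum of the changes of the gradient along the local models. -/
noncomputable def sumDev : Param d := ∑ k ∈ Finset.range K, a k • clientDev ηl c f g θ ζ k o

/-- The weighted sum of the gradient noises. -/
noncomputable def sumNoise : Param d := ∑ k ∈ Finset.range K, a k • clientNoise ηl c f g θ ζ k o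

/-- The weighted sum of the exact gradients at the local models. -/
noncomputable def sumGrad : Param d :=
  norm1 K a • gradient f (θ o) + sumDev ηl K a c f g θ ζ o

/-- The weighted sum of the stochastic gradients at the local models. -/
noncomputable def sumStochGrad : Param d :=
  sumGrad ηl K a c f g θ ζ o + sumNoise ηl K a c f g θ ζ o

end Defs

theorem norm1_eq_sum {K : ℕ} {a : ℕ → ℝ} (ha : ∀ k < K, 0 ≤ a k) :
    norm1 K a = ∑ k ∈ Finset.range K, a k :=
  Finset.sum_congr rfl fun k hk => abs_of_nonneg (ha k (Finset.mem_range.1 hk))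

theorem norm1_nonneg (K : ℕ) (a : ℕ → ℝ) : 0 ≤ norm1 K a :=
  Finset.sum_nonneg fun _ _ => abs_nonneg _

theorem norm2sq_nonneg (K : ℕ) (a : ℕ → ℝ) : 0 ≤ norm2sq K a :=
  Finset.sum_nonneg fun _ _ => sq_nonneg _

theorem norm1_succ_sub_lastCoeff {n : ℕ} {a : ℕ → ℝ} (ha : ∀ k < n + 1, 0 ≤ a k) :
    norm1 (n + 1) a - lastCoeff (n + 1) a = ∑ k ∈ Finset.range n, a k := by
  rw [norm1_eq_sum ha, Finset.sum_range_succ, lastCoeff, Nat.add_sub_cancel, add_sub_cancel_right]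

theorem norm2sq_succ_sub_lastCoeff_sq (n : ℕ) (a : ℕ → ℝ) :
    norm2sq (n + 1) a - lastCoeff (n + 1) a ^ 2 = ∑ k ∈ Finset.range n, a k ^ 2 := by
  rw [norm2sq, Finset.sum_range_succ, lastCoeff, Nat.add_sub_cancel, add_sub_cancel_right]

theorem localUpdate_eq {Ω Z : Type*} {d : ℕ} (ηl : ℝ) {K : ℕ} {a : ℕ → ℝ}
    (ha : ∀ k < K, 0 ≤ a k) (c : ℕ → ℕ → ℝ) (f : Param d → ℝ) (g : Param d → Z → Param d)
    (θ : Ω → Param d) (ζ : ℕ → Ω → Z) (o : Ω) :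
    localUpdate ηl K a c g (fun k => ζ k o) (θ o) = -(ηl • sumStochGrad ηl K a c f g θ ζ o) := by
  rw [localUpdate, sumStochGrad, sumGrad, sumDev, sumNoise, norm1_eq_sum ha, Finset.sum_smul,
    ← Finset.sum_add_distrib, ← Finset.sum_add_distrib]
  congr 2
  refine Finset.sum_congr rfl fun k _ => ?_
  rw [← smul_add, ← smul_add, clientDev, clientNoise, add_sub_cancel, add_sub_cancel]
  rfl

namespace ClientInputs

variable {Ω Z : Type*} [mΩ : MeasurableSpace Ω] [MeasurableSpace Z] {d : ℕ} {P : Measure Ω}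
  {D : Measure Z} {𝒢 : ℕ → MeasurableSpace Ω} {θ : Ω → Param d} {ζ : ℕ → Ω → Z} {L σ ηl : ℝ}
  {a : ℕ → ℝ} {c : ℕ → ℕ → ℝ} {f : Param d → ℝ} {g : Param d → Z → Param d} {K : ℕ}

section MemLp

variable [IsProbabilityMeasure P]

theorem memLp_sumDev (h : ClientInputs P D 𝒢 θ ζ) (hg : StochasticGradient D σ f g)
    (hf : Smooth L f) : MemLp (sumDev ηl K a c f g θ ζ) 2 P :=
  memLp_finsetSum _ fun k _ => (h.memLp_dev (ηl := ηl) (c := c) hg hf k).const_smul (a k)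

theorem memLp_sumNoise (h : ClientInputs P D 𝒢 θ ζ) (hg : StochasticGradient D σ f g)
    (hf : Smooth L f) : MemLp (sumNoise ηl K a c f g θ ζ) 2 P :=
  memLp_finsetSum _ fun k _ => (h.memLp_noise (ηl := ηl) (c := c) hg hf k).const_smul (a k)

theorem memLp_sumGrad (h : ClientInputs P D 𝒢 θ ζ) (hg : StochasticGradient D σ f g)
    (hf : Smooth L f) : MemLp (sumGrad ηl K a c f g θ ζ) 2 P :=
  ((memLp_two_comp_of_lipschitz hf h.memLp).const_smul (norm1 K a)).add (h.memLp_sumDev hg hf)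

theorem memLp_sumStochGrad (h : ClientInputs P D 𝒢 θ ζ) (hg : StochasticGradient D σ f g)
    (hf : Smooth L f) : MemLp (sumStochGrad ηl K a c f g θ ζ) 2 P :=
  (h.memLp_sumGrad hg hf).add (h.memLp_sumNoise hg hf)

theorem integral_inner_sumNoise (h : ClientInputs P D 𝒢 θ ζ) (hg : StochasticGradient D σ f g)
    (hf : Smooth L f) {V : Ω → Param d} (hV : ∀ k, Measurable[𝒢 k] V) (hV2 : MemLp V 2 P) :
    ∫ o, inner ℝ (V o) (sumNoise ηl K a c f g θ ζ o) ∂P = 0 := by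
  simp_rw [sumNoise, inner_sum, real_inner_smul_right]
  rw [integral_finsetSum _ fun k _ =>
    (integrable_inner_of_memLp_two hV2 (h.memLp_noise hg hf k)).const_mul _]
  refine Finset.sum_eq_zero fun k _ => ?_
  rw [integral_const_mul, h.integral_inner_noise hg hf (hV k) hV2, mul_zero]

theorem integral_sumNoise_sq_le (h : ClientInputs P D 𝒢 θ ζ) (hg : StochasticGradient D σ f g)
    (hf : Smooth L f) :
    ∫ o, ‖sumNoise ηl K a c f g θ ζ o‖ ^ 2 ∂P ≤ σ ^ 2 * norm2sq K a :=
  h.integral_sum_noise_sq_le hg hf a K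

theorem integral_sumGrad_sq_le (h : ClientInputs P D 𝒢 θ ζ) (hg : StochasticGradient D σ f g)
    (hf : Smooth L f) :
    ∫ o, ‖sumGrad ηl K a c f g θ ζ o‖ ^ 2 ∂P ≤ 2 * norm1 K a ^ 2 *
      ∫ o, ‖gradient f (θ o)‖ ^ 2 ∂P + 2 * ∫ o, ‖sumDev ηl K a c f g θ ζ o‖ ^ 2 ∂P := by
  have h1 := (h.integrable_gradient_sq hf).const_mul (2 * norm1 K a ^ 2)
  have h2 := ((h.memLp_sumDev (ηl := ηl) (K := K) (a := a) (c := c) hg hf).integrable_norm_pow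
    two_ne_zero).const_mul 2
  rw [← integral_const_mul, ← integral_const_mul, ← integral_add h1 h2]
  refine integral_mono ((h.memLp_sumGrad hg hf).integrable_norm_pow two_ne_zero) (h1.add h2)
    fun o => ?_
  have h3 := norm_add_sq_le_two (norm1 K a • gradient f (θ o)) (sumDev ηl K a c f g θ ζ o)
  rw [norm_smul, mul_pow, Real.norm_eq_abs, sq_abs, ← mul_assoc] at h3
  exact h3

/-- The second moment of the accumulated stochastic gradient.  The exact gradients and the noises
of one client are correlated, but only through the drift of the local models. -/
theorem integral_sumStochGrad_sq_sub_le (h : ClientInputs P D 𝒢 θ ζ)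
    (hg : StochasticGradient D σ f g) (hf : Smooth L f) :
    ∫ o, ‖sumStochGrad ηl K a c f g θ ζ o‖ ^ 2 ∂P - ∫ o, ‖sumGrad ηl K a c f g θ ζ o‖ ^ 2 ∂P
      ≤ 2 * ∫ o, ‖sumDev ηl K a c f g θ ζ o‖ ^ 2 ∂P + 3 / 2 * (σ ^ 2 * norm2sq K a) := by
  have hn := h.memLp_sumNoise (ηl := ηl) (K := K) (a := a) (c := c) hg hf
  have hV := h.memLp_sumDev (ηl := ηl) (K := K) (a := a) (c := c) hg hf
  have hG := memLp_two_comp_of_lipschitz hf h.memLp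
  -- The gradient at the starting point is known before every batch of the round, so only the
  -- deviation part of the exact gradients can correlate with the noise.
  have h0 : ∫ o, inner ℝ (gradient f (θ o)) (sumNoise ηl K a c f g θ ζ o) ∂P = 0 :=
    h.integral_inner_sumNoise hg hf
      (fun k => hf.measurable_gradient.comp (h.measurable_start k)) hG
  have i0 := integrable_inner_of_memLp_two hG hn
  have i1 := hV.integrable_norm_pow two_ne_zero
  have i2 := hn.integrable_norm_pow two_ne_zero
  have h3 : ∫ o, ‖sumStochGrad ηl K a c f g θ ζ o‖ ^ 2 ∂P
      - ∫ o, ‖sumGrad ηl K a c f g θ ζ o‖ ^ 2 ∂P ≤ ∫ o, (2 * norm1 K a *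
        inner ℝ (gradient f (θ o)) (sumNoise ηl K a c f g θ ζ o)
        + (2 * ‖sumDev ηl K a c f g θ ζ o‖ ^ 2
          + 3 / 2 * ‖sumNoise ηl K a c f g θ ζ o‖ ^ 2)) ∂P := by
    rw [← integral_sub ((h.memLp_sumStochGrad hg hf).integrable_norm_pow two_ne_zero)
      ((h.memLp_sumGrad hg hf).integrable_norm_pow two_ne_zero)]
    refine integral_mono
      (((h.memLp_sumStochGrad hg hf).integrable_norm_pow two_ne_zero).sub
        ((h.memLp_sumGrad hg hf).integrable_norm_pow two_ne_zero))
      ((i0.const_mul _).add ((i1.const_mul _).add (i2.const_mul _))) fun o => ?_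
    have h4 := norm_add_sq_real (sumGrad ηl K a c f g θ ζ o) (sumNoise ηl K a c f g θ ζ o)
    have h5 : inner ℝ (sumGrad ηl K a c f g θ ζ o) (sumNoise ηl K a c f g θ ζ o)
        = norm1 K a * inner ℝ (gradient f (θ o)) (sumNoise ηl K a c f g θ ζ o)
          + inner ℝ (sumDev ηl K a c f g θ ζ o) (sumNoise ηl K a c f g θ ζ o) := by
      rw [sumGrad, inner_add_left, real_inner_smul_left]
    have h6 := real_inner_le_norm (sumDev ηl K a c f g θ ζ o) (sumNoise ηl K a c f g θ ζ o)
    change ‖sumGrad ηl K a c f g θ ζ o + sumNoise ηl K a c f g θ ζ o‖ ^ 2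
      - ‖sumGrad ηl K a c f g θ ζ o‖ ^ 2 ≤ 2 * norm1 K a *
        inner ℝ (gradient f (θ o)) (sumNoise ηl K a c f g θ ζ o)
        + (2 * ‖sumDev ηl K a c f g θ ζ o‖ ^ 2 + 3 / 2 * ‖sumNoise ηl K a c f g θ ζ o‖ ^ 2)
    -- 2‖V‖‖N‖ ≤ 2‖V‖² + ‖N‖²/2, and the half is added to the ‖N‖² of the expansion.
    nlinarith [sq_nonneg (2 * ‖sumDev ηl K a c f g θ ζ o‖ - ‖sumNoise ηl K a c f g θ ζ o‖)]
  have i12 : Integrable (fun o => 2 * ‖sumDev ηl K a c f g θ ζ o‖ ^ 2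
      + 3 / 2 * ‖sumNoise ηl K a c f g θ ζ o‖ ^ 2) P := (i1.const_mul _).add (i2.const_mul _)
  rw [integral_add (i0.const_mul _) i12, integral_add (i1.const_mul _) (i2.const_mul _), integral_const_mul, integral_const_mul,
    integral_const_mul, h0] at h3
  have h7 := h.integral_sumNoise_sq_le (ηl := ηl) (K := K) (a := a) (c := c) hg hf
  linarith

theorem sum_integral_drift_le_norm (h : ClientInputs P D 𝒢 θ ζ) (hg : StochasticGradient D σ f g)
    (hf : Smooth L f) (hK : 0 < K) (ha : ∀ k < K, 0 ≤ a k)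
    (hc : ∀ k < K, ∀ s < k, 0 ≤ c k s ∧ c k s ≤ a s)
    (hsmall : 32 * ηl ^ 2 * L ^ 2 * (norm1 K a * (norm1 K a - lastCoeff K a)) ≤ 1) :
    ∑ k ∈ Finset.range K, a k * ∫ o, ‖clientModel ηl c g θ ζ k o - θ o‖ ^ 2 ∂P
      ≤ norm1 K a * (9 / 4 * ηl ^ 2 * (σ ^ 2 * (norm2sq K a - lastCoeff K a ^ 2)) + 3 / 2 * ηl ^ 2 *
          (norm1 K a * (norm1 K a - lastCoeff K a)) * ∫ o, ‖gradient f (θ o)‖ ^ 2 ∂P) := by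
  obtain ⟨n, rfl⟩ : ∃ n, K = n + 1 := ⟨K - 1, by omega⟩
  rw [norm1_succ_sub_lastCoeff ha, norm2sq_succ_sub_lastCoeff_sq, norm1_eq_sum ha] at *
  exact h.sum_integral_drift_le hg hf ha hc hsmall

theorem integral_sumDev_sq_le (h : ClientInputs P D 𝒢 θ ζ) (hg : StochasticGradient D σ f g)
    (hf : Smooth L f) (ha : ∀ k < K, 0 ≤ a k) :
    ∫ o, ‖sumDev ηl K a c f g θ ζ o‖ ^ 2 ∂P ≤ norm1 K a * (L ^ 2 *
      ∑ k ∈ Finset.range K, a k * ∫ o, ‖clientModel ηl c g θ ζ k o - θ o‖ ^ 2 ∂P) := by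
  rw [norm1_eq_sum ha]
  exact h.integral_sum_dev_sq_le hg hf ha

end MemLp

end ClientInputs

theorem measurable_sumGrad {Ω Z : Type*} [MeasurableSpace Ω] [MeasurableSpace Z] {d : ℕ}
    {L σ ηl : ℝ} {K : ℕ} {a : ℕ → ℝ} {c : ℕ → ℕ → ℝ} {f : Param d → ℝ} {g : Param d → Z → Param d}
    {D : Measure Z} (hg : StochasticGradient D σ f g) (hf : Smooth L f) {θ : Ω → Param d}
    (hθ : Measurable θ) {ζ : ℕ → Ω → Z} (hζ : ∀ k, Measurable (ζ k)) :
    Measurable (sumGrad ηl K a c f g θ ζ) := by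
  refine ((hf.measurable_gradient.comp hθ).const_smul (norm1 K a)).add ?_
  exact Finset.measurable_fun_sum _ fun k _ => ((hf.measurable_gradient.comp
    (measurable_localModel ηl c hg.measurable hθ k fun s _ => hζ s)).sub
      (hf.measurable_gradient.comp hθ)).const_smul (a k)

theorem measurable_sumNoise {Ω Z : Type*} [MeasurableSpace Ω] [MeasurableSpace Z] {d : ℕ}
    {L σ ηl : ℝ} {K : ℕ} {a : ℕ → ℝ} {c : ℕ → ℕ → ℝ} {f : Param d → ℝ} {g : Param d → Z → Param d}
    {D : Measure Z} (hg : StochasticGradient D σ f g) (hf : Smooth L f) {θ : Ω → Param d}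
    (hθ : Measurable θ) {ζ : ℕ → Ω → Z} (hζ : ∀ k, Measurable (ζ k)) :
    Measurable (sumNoise ηl K a c f g θ ζ) :=
  Finset.measurable_fun_sum _ fun k _ => ((hg.measurable_noise hf).comp
    ((measurable_localModel ηl c hg.measurable hθ k fun s _ => hζ s).prodMk (hζ k))).const_smul
      (a k)

theorem measurable_sumStochGrad {Ω Z : Type*} [MeasurableSpace Ω] [MeasurableSpace Z] {d : ℕ}
    {L σ ηl : ℝ} {K : ℕ} {a : ℕ → ℝ} {c : ℕ → ℕ → ℝ} {f : Param d → ℝ} {g : Param d → Z → Param d}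
    {D : Measure Z} (hg : StochasticGradient D σ f g) (hf : Smooth L f) {θ : Ω → Param d}
    (hθ : Measurable θ) {ζ : ℕ → Ω → Z} (hζ : ∀ k, Measurable (ζ k)) :
    Measurable (sumStochGrad ηl K a c f g θ ζ) :=
  (measurable_sumGrad hg hf hθ hζ).add (measurable_sumNoise hg hf hθ hζ)

/-! ### Random weights -/

section Weights

variable {Ω : Type*} [MeasurableSpace Ω] {P : Measure Ω} {d M : ℕ}
  {w : Fin M → Ω → ℝ} {G : Fin M → Ω → Param d}

/-- Without independence a product of two L² functions is only in L¹; here |w|² and ‖G‖² are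
independent and integrable. -/
theorem memLp_smul_of_indepFun {w : Ω → ℝ} {G : Ω → Param d} (hw : MemLp w 2 P)
    (hG : MemLp G 2 P) (h : IndepFun w G P) : MemLp (fun o => w o • G o) 2 P := by
  have hm : AEStronglyMeasurable (fun o => w o • G o) P := hw.1.smul hG.1
  rw [memLp_two_iff_integrable_sq_norm hm]
  simp_rw [norm_smul, mul_pow]
  exact (h.comp (measurable_norm.pow_const 2) (measurable_norm.pow_const 2)).integrable_mul
    (hw.integrable_norm_pow two_ne_zero) (hG.integrable_norm_pow two_ne_zero)

theorem integral_norm_sum_smul_sq (hw : ∀ i, MemLp (w i) 2 P) (hG : ∀ i, MemLp (G i) 2 P)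
    (h : IndepFun (fun o i => w i o) (fun o i => G i o) P) :
    ∫ o, ‖∑ i, w i o • G i o‖ ^ 2 ∂P
      = ∑ i, ∑ j, (∫ o, w i o * w j o ∂P) * ∫ o, inner ℝ (G i o) (G j o) ∂P := by
  rw [integral_norm_sum_sq (X := fun i o => w i o • G i o) _ fun i _ =>
    memLp_smul_of_indepFun (hw i) (hG i) (h.comp (measurable_pi_apply i) (measurable_pi_apply i))]
  refine Finset.sum_congr rfl fun i _ => Finset.sum_congr rfl fun j _ => ?_
  have h1 : IndepFun (fun o => w i o * w j o) (fun o => inner ℝ (G i o) (G j o)) P :=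
    h.comp (φ := fun v : Fin M → ℝ => v i * v j)
      (ψ := fun v : Fin M → Param d => inner ℝ (v i) (v j))
      ((measurable_pi_apply i).mul (measurable_pi_apply j))
      ((measurable_pi_apply i).inner (measurable_pi_apply j))
  rw [← h1.integral_fun_mul_eq_mul_integral ((hw i).1.mul (hw j).1) ((hG i).1.inner (hG j).1)]
  refine integral_congr_ae (Filter.Eventually.of_forall fun o => ?_)
  simp only [real_inner_smul_left, real_inner_smul_right]
  ring

theorem integral_inner_sum_smul {U : Ω → Param d} (hU : MemLp U 2 P) (hw : ∀ i, MemLp (w i) 2 P)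
    (hG : ∀ i, MemLp (G i) 2 P)
    (h : IndepFun (fun o i => w i o) (fun o => (U o, fun i => G i o)) P) :
    ∫ o, inner ℝ (U o) (∑ i, w i o • G i o) ∂P
      = ∑ i, (∫ o, w i o ∂P) * ∫ o, inner ℝ (U o) (G i o) ∂P := by
  simp_rw [inner_sum]
  rw [integral_finsetSum _ fun i _ => integrable_inner_of_memLp_two hU
    (memLp_smul_of_indepFun (hw i) (hG i) (h.comp (measurable_pi_apply i)
      ((measurable_pi_apply i).comp measurable_snd)))]
  refine Finset.sum_congr rfl fun i _ => ?_
  have h1 : IndepFun (w i) (fun o => inner ℝ (U o) (G i o)) P :=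
    h.comp (φ := fun v : Fin M → ℝ => v i)
      (ψ := fun v : Param d × (Fin M → Param d) => inner ℝ v.1 (v.2 i))
      (measurable_pi_apply i) (measurable_fst.inner ((measurable_pi_apply i).comp measurable_snd))
  rw [← h1.integral_fun_mul_eq_mul_integral (hw i).1 (hU.1.inner (hG i).1)]
  simp_rw [real_inner_smul_right]

end Weights

/-! ### One round -/

/-- The inputs of one round: the starting point `θ`, the sampling outcome `s` and the batches `ζ`.
The batch `ζ i k` is independent of `𝒢 i k`, which contains the starting point, the batches of the
other clients and the earlier batches of client `i`; the outcome `s` is independent of `ℋ`, which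
contains the starting point and all the batches. -/
structure RoundInputs {Ω 𝒮 Z : Type*} (ℋ : MeasurableSpace Ω) [mΩ : MeasurableSpace Ω]
    [MeasurableSpace 𝒮] [MeasurableSpace Z] {d M : ℕ} (P : Measure Ω) (ν : Measure 𝒮) (D : Fin M → Measure Z)
    (𝒢 : Fin M → ℕ → MeasurableSpace Ω) (θ : Ω → Param d) (s : Ω → 𝒮)
    (ζ : Fin M → ℕ → Ω → Z) : Prop where
  client : ∀ i, ClientInputs P (D i) (𝒢 i) θ (ζ i)
  measurable_other : ∀ i k j, j ≠ i → ∀ r, Measurable[𝒢 i k] (ζ j r)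
  measurable_start : Measurable[ℋ] θ
  measurable_batch : ∀ i k, Measurable[ℋ] (ζ i k)
  measurable_outcome : Measurable s
  law : P.map s = ν
  indep : Indep ℋ (MeasurableSpace.comap s inferInstance) P

/-- Second moments of the weights form a rank-one matrix plus a diagonal, γ_i being exactly the
diagonal excess. The rank-one part reassembles the double sum over clients into (1-α) ‖∑ p_i H_i‖².
-/
theorem SamplingScheme.integral_mul {M : ℕ} {𝒮 : Type*} [MeasurableSpace 𝒮] {ν : Measure 𝒮}
    [IsProbabilityMeasure ν] {ω : 𝒮 → Fin M → ℝ} {p : Fin M → ℝ} {α : ℝ}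
    (hω : SamplingScheme ν ω p α) (i j : Fin M) :
    ∫ s, ω s i * ω s j ∂ν = (1 - α) * (p i * p j) + if i = j then gam ν ω p α i else 0 := by
  have h := covariance_eq_sub (hω.memLp i) (hω.memLp j)
  simp only [hω.unbiased, Pi.mul_apply] at h
  split_ifs with hij
  · subst hij
    rw [covariance_self (hω.measurable i).aemeasurable] at h
    rw [gam]
    linarith
  · rw [hω.cov_eq i j hij] at h
    linarith

namespace RoundInputs

variable {Ω 𝒮 Z : Type*} {ℋ : MeasurableSpace Ω} [mΩ : MeasurableSpace Ω]
  [MeasurableSpace 𝒮] [MeasurableSpace Z] {d M : ℕ} {P : Measure Ω} {ν : Measure 𝒮} {D : Fin M → Measure Z}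
  {𝒢 : Fin M → ℕ → MeasurableSpace Ω} {θ : Ω → Param d} {s : Ω → 𝒮}
  {ζ : Fin M → ℕ → Ω → Z} {L σ ηl α : ℝ} {K : ℕ} {a : Fin M → ℕ → ℝ} {c : Fin M → ℕ → ℕ → ℝ}
  {f : Fin M → Param d → ℝ} {g : Fin M → Param d → Z → Param d} {ω : 𝒮 → Fin M → ℝ}
  {p : Fin M → ℝ}

theorem measurable_sumGrad_other (h : RoundInputs ℋ P ν D 𝒢 θ s ζ)
    (hg : ∀ i, StochasticGradient (D i) σ (f i) (g i)) (hf : ∀ i, Smooth L (f i))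
    {i j : Fin M} (hij : j ≠ i) (k : ℕ) :
    Measurable[𝒢 i k] (sumGrad ηl K (a j) (c j) (f j) (g j) θ (ζ j)) :=
  @measurable_sumGrad Ω Z (𝒢 i k) _ d L σ ηl K (a j) (c j) (f j) (g j) (D j) (hg j) (hf j) θ
    ((h.client i).measurable_start k) (ζ j) (h.measurable_other i k j hij)

theorem measurable_sumNoise_other (h : RoundInputs ℋ P ν D 𝒢 θ s ζ)
    (hg : ∀ i, StochasticGradient (D i) σ (f i) (g i)) (hf : ∀ i, Smooth L (f i))
    {i j : Fin M} (hij : j ≠ i) (k : ℕ) :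
    Measurable[𝒢 i k] (sumNoise ηl K (a j) (c j) (f j) (g j) θ (ζ j)) :=
  @measurable_sumNoise Ω Z (𝒢 i k) _ d L σ ηl K (a j) (c j) (f j) (g j) (D j) (hg j) (hf j) θ
    ((h.client i).measurable_start k) (ζ j) (h.measurable_other i k j hij)

/-- The gradient of F is carried along with the updates so that one independence statement serves
both the inner product and the second moment. -/
theorem indepFun_weights (h : RoundInputs ℋ P ν D 𝒢 θ s ζ)
    (hg : ∀ i, StochasticGradient (D i) σ (f i) (g i)) (hf : ∀ i, Smooth L (f i))
    (hω : SamplingScheme ν ω p α) {F : Param d → ℝ} (hF : Smooth L F) :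
    IndepFun (fun o i => ω (s o) i) (fun o => (gradient F (θ o),
      fun i => sumStochGrad ηl K (a i) (c i) (f i) (g i) θ (ζ i) o)) P := by
  have hm : Measurable[ℋ] fun o => (gradient F (θ o),
      fun i => sumStochGrad ηl K (a i) (c i) (f i) (g i) θ (ζ i) o) :=
    (hF.measurable_gradient.comp h.measurable_start).prodMk
      (@measurable_pi_lambda Ω (Fin M) (fun _ => Param d) ℋ _ _ fun i =>
        @measurable_sumStochGrad Ω Z ℋ _ d L σ ηl K (a i) (c i) (f i) (g i) (D i) (hg i) (hf i) θ
          h.measurable_start (ζ i) (h.measurable_batch i))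
  exact ((indepFun_of_indep hm h.indep).comp measurable_id
    (measurable_pi_lambda _ hω.measurable)).symm

theorem memLp_weight (h : RoundInputs ℋ P ν D 𝒢 θ s ζ) (hω : SamplingScheme ν ω p α) (i : Fin M) :
    MemLp (fun o => ω (s o) i) 2 P :=
  (h.law ▸ hω.memLp i : MemLp (fun s => ω s i) 2 (P.map s)).comp_of_map
    h.measurable_outcome.aemeasurable

theorem integral_comp_outcome (h : RoundInputs ℋ P ν D 𝒢 θ s ζ) {φ : 𝒮 → ℝ} (hφ : Measurable φ) :
    ∫ o, φ (s o) ∂P = ∫ x, φ x ∂ν := by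
  rw [← h.law, integral_map h.measurable_outcome.aemeasurable hφ.aestronglyMeasurable]

variable [IsProbabilityMeasure P]

/-- Gradient sum and noise sum of client i depend only on the start and on its own batches, all
contained in the information against which the noise of client j is centred; the same holds with i
and j exchanged. Only the product of the exact parts survives. -/
theorem integral_inner_sumStochGrad_of_ne (h : RoundInputs ℋ P ν D 𝒢 θ s ζ)
    (hg : ∀ i, StochasticGradient (D i) σ (f i) (g i)) (hf : ∀ i, Smooth L (f i))
    {i j : Fin M} (hij : i ≠ j) :
    ∫ o, inner ℝ (sumStochGrad ηl K (a i) (c i) (f i) (g i) θ (ζ i) o)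
        (sumStochGrad ηl K (a j) (c j) (f j) (g j) θ (ζ j) o) ∂P
      = ∫ o, inner ℝ (sumGrad ηl K (a i) (c i) (f i) (g i) θ (ζ i) o)
        (sumGrad ηl K (a j) (c j) (f j) (g j) θ (ζ j) o) ∂P := by
  have hH := fun i => (h.client i).memLp_sumGrad (ηl := ηl) (K := K) (a := a i) (c := c i)
    (hg i) (hf i)
  have hN := fun i => (h.client i).memLp_sumNoise (ηl := ηl) (K := K) (a := a i) (c := c i)
    (hg i) (hf i)
  have h1 := (h.client j).integral_inner_sumNoise (ηl := ηl) (K := K) (a := a j) (c := c j) (hg j)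
    (hf j) (fun k => h.measurable_sumGrad_other (ηl := ηl) (K := K) (a := a) (c := c) hg hf hij k)
    (hH i)
  have h2 := (h.client j).integral_inner_sumNoise (ηl := ηl) (K := K) (a := a j) (c := c j) (hg j)
    (hf j) (fun k => h.measurable_sumNoise_other (ηl := ηl) (K := K) (a := a) (c := c) hg hf hij k)
    (hN i)
  have h3 := (h.client i).integral_inner_sumNoise (ηl := ηl) (K := K) (a := a i) (c := c i) (hg i)
    (hf i) (fun k => h.measurable_sumGrad_other (ηl := ηl) (K := K) (a := a) (c := c) hg hf
      hij.symm k) (hH j)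
  simp_rw [sumStochGrad]
  rw [integral_inner_add_add (hH i) (hN i) (hH j) (hN j), h1, h2]
  simp_rw [real_inner_comm (sumGrad ηl K (a j) (c j) (f j) (g j) θ (ζ j) _)
    (sumNoise ηl K (a i) (c i) (f i) (g i) θ (ζ i) _)]
  rw [h3]
  simp

/-- The second moment of the aggregated update. -/
theorem integral_norm_sum_weights_sq_le [IsProbabilityMeasure ν]
    (h : RoundInputs ℋ P ν D 𝒢 θ s ζ)
    (hg : ∀ i, StochasticGradient (D i) σ (f i) (g i)) (hf : ∀ i, Smooth L (f i))
    (hω : SamplingScheme ν ω p α) (hγ : ∀ i, 0 ≤ gam ν ω p α i) {F : Param d → ℝ}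
    (hF : Smooth L F) :
    ∫ o, ‖∑ i, ω (s o) i • sumStochGrad ηl K (a i) (c i) (f i) (g i) θ (ζ i) o‖ ^ 2 ∂P
      ≤ (1 - α) * ∫ o, ‖∑ i, p i • sumGrad ηl K (a i) (c i) (f i) (g i) θ (ζ i) o‖ ^ 2 ∂P
        + ∑ i, (gam ν ω p α i * (2 * norm1 K (a i) ^ 2 * ∫ o, ‖gradient (f i) (θ o)‖ ^ 2 ∂P
            + 2 * ∫ o, ‖sumDev ηl K (a i) (c i) (f i) (g i) θ (ζ i) o‖ ^ 2 ∂P)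
          + (variance (fun s => ω s i) ν + p i ^ 2) *
            (2 * ∫ o, ‖sumDev ηl K (a i) (c i) (f i) (g i) θ (ζ i) o‖ ^ 2 ∂P
              + 3 / 2 * (σ ^ 2 * norm2sq K (a i)))) := by
  have hG := fun i => (h.client i).memLp_sumStochGrad (ηl := ηl) (K := K) (a := a i) (c := c i)
    (hg i) (hf i)
  have hH := fun i => (h.client i).memLp_sumGrad (ηl := ηl) (K := K) (a := a i) (c := c i)
    (hg i) (hf i)
  have hind := h.indepFun_weights (ηl := ηl) (K := K) (a := a) (c := c) hg hf hω hF
  rw [integral_norm_sum_smul_sq (w := fun i o => ω (s o) i) (h.memLp_weight hω) hG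
    (hind.comp measurable_id measurable_snd),
    integral_norm_sum_sq (X := fun i o => p i • sumGrad ηl K (a i) (c i) (f i) (g i) θ (ζ i) o) _
      fun i _ => (hH i).const_smul (p i), Finset.mul_sum, ← Finset.sum_add_distrib]
  refine Finset.sum_le_sum fun i _ => ?_
  have hE : ∀ j, ∫ o, ω (s o) i * ω (s o) j ∂P
      = (1 - α) * (p i * p j) + if i = j then gam ν ω p α i else 0 := fun j => by
    rw [h.integral_comp_outcome (φ := fun x => ω x i * ω x j)
      ((hω.measurable i).mul (hω.measurable j)), hω.integral_mul]
  set J : Fin M → ℝ := fun j => ∫ o, inner ℝ (sumGrad ηl K (a i) (c i) (f i) (g i) θ (ζ i) o)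
    (sumGrad ηl K (a j) (c j) (f j) (g j) θ (ζ j) o) ∂P with hJ
  set I := ∫ o, ‖sumStochGrad ηl K (a i) (c i) (f i) (g i) θ (ζ i) o‖ ^ 2 ∂P with hI
  have hJi : J i = ∫ o, ‖sumGrad ηl K (a i) (c i) (f i) (g i) θ (ζ i) o‖ ^ 2 ∂P := by
    simp_rw [hJ, real_inner_self_eq_norm_sq]
  have hIJ : ∀ j, ∫ o, inner ℝ (sumStochGrad ηl K (a i) (c i) (f i) (g i) θ (ζ i) o)
      (sumStochGrad ηl K (a j) (c j) (f j) (g j) θ (ζ j) o) ∂P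
        = J j + if i = j then I - J i else 0 := by
    intro j
    split_ifs with hij
    · subst hij
      simp_rw [real_inner_self_eq_norm_sq]
      rw [hI]
      ring
    · rw [h.integral_inner_sumStochGrad_of_ne hg hf hij, add_zero]
  have hpJ : ∀ j, ∫ o, inner ℝ (p i • sumGrad ηl K (a i) (c i) (f i) (g i) θ (ζ i) o)
      (p j • sumGrad ηl K (a j) (c j) (f j) (g j) θ (ζ j) o) ∂P = p i * p j * J j := by
    intro j
    simp_rw [real_inner_smul_left, real_inner_smul_right]
    rw [integral_const_mul, integral_const_mul, ← mul_assoc]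
  simp_rw [hE, hIJ, hpJ]
  -- On the diagonal (1-α) p_i² + γ_i = Var[ω_i] + p_i², which is therefore the weight of the excess
  -- `I - J i`.
  have hsum : ∑ j, ((1 - α) * (p i * p j) + if i = j then gam ν ω p α i else 0) *
      (J j + if i = j then I - J i else 0) = (1 - α) * ∑ j, p i * p j * J j
        + (gam ν ω p α i * J i + (variance (fun s => ω s i) ν + p i ^ 2) * (I - J i)) := by
    have h1 : ∀ j, ((1 - α) * (p i * p j) + if i = j then gam ν ω p α i else 0) *
        (J j + if i = j then I - J i else 0) = (1 - α) * (p i * p j * J j)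
          + if i = j then gam ν ω p α i * J i
            + (variance (fun s => ω s i) ν + p i ^ 2) * (I - J i) else 0 := by
      intro j
      split_ifs with hij
      · subst hij
        rw [gam]
        ring
      · ring
    simp_rw [h1]
    rw [Finset.sum_add_distrib, ← Finset.mul_sum, Finset.sum_ite_eq, if_pos (Finset.mem_univ i)]
  rw [hsum]
  have hvar : 0 ≤ variance (fun s => ω s i) ν + p i ^ 2 :=
    add_nonneg (variance_nonneg _ _) (sq_nonneg _)
  have h2 := (h.client i).integral_sumGrad_sq_le (ηl := ηl) (K := K) (a := a i) (c := c i)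
    (hg i) (hf i)
  have h3 := (h.client i).integral_sumStochGrad_sq_sub_le (ηl := ηl) (K := K) (a := a i)
    (c := c i) (hg i) (hf i)
  rw [← hJi] at h2 h3
  gcongr
  exact hγ i

/-- The mean of the aggregated update, tested against the gradient at the starting point. -/
theorem integral_inner_sum_weights [IsProbabilityMeasure ν] (h : RoundInputs ℋ P ν D 𝒢 θ s ζ)
    (hg : ∀ i, StochasticGradient (D i) σ (f i) (g i)) (hf : ∀ i, Smooth L (f i))
    (hω : SamplingScheme ν ω p α) {F : Param d → ℝ} (hF : Smooth L F) (hθ : MemLp θ 2 P) :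
    ∫ o, inner ℝ (gradient F (θ o))
        (∑ i, ω (s o) i • sumStochGrad ηl K (a i) (c i) (f i) (g i) θ (ζ i) o) ∂P
      = ∫ o, inner ℝ (gradient F (θ o))
        (∑ i, p i • sumGrad ηl K (a i) (c i) (f i) (g i) θ (ζ i) o) ∂P := by
  have hU := memLp_two_comp_of_lipschitz hF hθ
  have hG := fun i => (h.client i).memLp_sumStochGrad (ηl := ηl) (K := K) (a := a i) (c := c i)
    (hg i) (hf i)
  have hH := fun i => (h.client i).memLp_sumGrad (ηl := ηl) (K := K) (a := a i) (c := c i)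
    (hg i) (hf i)
  have hN := fun i => (h.client i).memLp_sumNoise (ηl := ηl) (K := K) (a := a i) (c := c i)
    (hg i) (hf i)
  rw [integral_inner_sum_smul (w := fun i o => ω (s o) i) hU (h.memLp_weight hω) hG
    (h.indepFun_weights hg hf hω hF)]
  simp_rw [inner_sum, real_inner_smul_right]
  rw [integral_finsetSum _ fun i _ => (integrable_inner_of_memLp_two hU (hH i)).const_mul (p i)]
  refine Finset.sum_congr rfl fun i _ => ?_
  rw [h.integral_comp_outcome (hω.measurable i), hω.unbiased]
  rw [integral_const_mul]
  congr 1
  simp_rw [sumStochGrad, inner_add_right]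
  rw [integral_add (integrable_inner_of_memLp_two hU (hH i))
    (integrable_inner_of_memLp_two hU (hN i)), (h.client i).integral_inner_sumNoise (hg i) (hf i)
      (V := fun o => gradient F (θ o)) (fun k => hF.measurable_gradient.comp ((h.client i).measurable_start k)) hU, add_zero]

end RoundInputs

/-- The quadratic bound based at 0 dominates F(Y) from above; based at Y and evaluated at 0, it
dominates F(Y) from below. -/
theorem Smooth.integrable_comp {Ω : Type*} [MeasurableSpace Ω] {P : Measure Ω}
    [IsFiniteMeasure P] {d : ℕ} {L : ℝ} {F : Param d → ℝ} (h : Smooth L F) {Y : Ω → Param d}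
    (hY : MemLp Y 2 P) : Integrable (fun o => F (Y o)) P := by
  have h1 := (hY.integrable_norm_pow two_ne_zero).const_mul (L / 2)
  have h2 := integrable_inner_of_memLp_two (memLp_two_comp_of_lipschitz h hY) hY
  have h3 := (hY.integrable one_le_two).const_inner (𝕜 := ℝ) (gradient F 0)
  refine integrable_of_le_of_le
    (g₁ := fun o => F 0 + inner ℝ (gradient F (Y o)) (Y o) - L / 2 * ‖Y o‖ ^ 2)
    (g₂ := fun o => F 0 + inner ℝ (gradient F 0) (Y o) + L / 2 * ‖Y o‖ ^ 2)
    (h.1.continuous.comp_aestronglyMeasurable hY.1) (Filter.Eventually.of_forall fun o => ?_)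
    (Filter.Eventually.of_forall fun o => ?_)
    (((integrable_const _).add h2).sub h1) (((integrable_const _).add h3).add h1)
  · have := h.le_quadratic (Y o) 0
    simp only [zero_sub, inner_neg_right, norm_neg] at this
    simp only
    linarith
  · have := h.le_quadratic 0 (Y o)
    simpa only [sub_zero] using this

/-! ### The bookkeeping of the constants of one round -/

section Scalar

variable {e L σ β κ η Q C Em a ab B n2 N v γ w u α p : ℝ}

/-- Contribution of one client to the second moment of the update. -/
theorem client_second_moment_le (he : 0 ≤ e) (hQ : 0 ≤ Q) (hab : 0 ≤ ab)
    (habC : ab ≤ C) (haE : a ^ 2 ≤ Em) (hNQ : N ≤ Q)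
    (hsmall : 32 * e * L ^ 2 * ab ≤ 1) (hB1 : 32 * e * L ^ 2 * (a ^ 2 * B) ≤ ab)
    (hB2 : 32 * e * L ^ 2 * (a ^ 2 * B) ≤ 5 / 4 * n2)
    (hv : v ≤ a ^ 2 * L ^ 2 * (9 / 4 * e * (σ ^ 2 * B) + 3 / 2 * e * ab * N))
    (hγ : 0 ≤ γ) (hw : 0 ≤ w) (hwγ : w ≤ γ + u * p ^ 2) (hu : 0 ≤ u) :
    γ * (2 * a ^ 2 * N + 2 * v) + w * (2 * v + 3 / 2 * (σ ^ 2 * n2))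
      ≤ γ * (35 / 16 * Em * Q + 9 / 64 * (C * σ ^ 2)) + 429 / 256 * σ ^ 2 * (w * n2)
        + u * (p * a) ^ 2 * (3 * e * L ^ 2 * C * Q) := by
  have hσ := sq_nonneg σ
  have ha2 := sq_nonneg a
  have heL : 0 ≤ e * L ^ 2 := by positivity
  have hN1 : a ^ 2 * L ^ 2 * (3 / 2 * e * ab * N) ≤ 3 / 2 * (e * L ^ 2 * ab * Q) * a ^ 2 := by
    have : e * L ^ 2 * ab * a ^ 2 * N ≤ e * L ^ 2 * ab * a ^ 2 * Q := by gcongr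
    linarith
  have hN2 : e * L ^ 2 * ab * Q * a ^ 2 ≤ 1 / 32 * (a ^ 2 * Q) := by
    have := mul_le_mul_of_nonneg_right hsmall (mul_nonneg ha2 hQ)
    linarith
  have hN3 : a ^ 2 * Q ≤ Em * Q := by gcongr
  -- Two bounds for the same deviation. The first charges its noise to `C`; multiplied by γ it feeds
  -- the constant D. The second charges it to ‖a‖₂²; multiplied by Var + p² it feeds A.
  have hv1 : 2 * v ≤ 9 / 64 * (ab * σ ^ 2) + 3 / 32 * (Em * Q) := by
    have := mul_le_mul_of_nonneg_right hB1 hσ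
    linarith
  have hv2 : 2 * v ≤ 45 / 256 * (σ ^ 2 * n2) + 3 * (e * L ^ 2 * ab * Q) * a ^ 2 := by
    have := mul_le_mul_of_nonneg_right hB2 hσ
    linarith
  have h1 : 2 * a ^ 2 * N + 2 * v ≤ (2 + 3 / 32) * Em * Q + 9 / 64 * (C * σ ^ 2) := by
    have h2 : a ^ 2 * N ≤ a ^ 2 * Q := by gcongr
    have h3 : ab * σ ^ 2 ≤ C * σ ^ 2 := by gcongr
    linarith
  have h4 := mul_le_mul_of_nonneg_left h1 hγ
  have h5 := mul_le_mul_of_nonneg_left hv2 hw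
  have hX : 0 ≤ 3 * (e * L ^ 2 * ab * Q) * a ^ 2 := by positivity
  have h6 : w * (3 * (e * L ^ 2 * ab * Q) * a ^ 2)
      ≤ γ * (3 / 32 * (Em * Q)) + u * p ^ 2 * (3 * (e * L ^ 2 * C * Q) * a ^ 2) := by
    calc w * (3 * (e * L ^ 2 * ab * Q) * a ^ 2)
        ≤ (γ + u * p ^ 2) * (3 * (e * L ^ 2 * ab * Q) * a ^ 2) := by gcongr
      _ = γ * (3 * (e * L ^ 2 * ab * Q * a ^ 2))
          + u * p ^ 2 * (3 * (e * L ^ 2 * ab * Q) * a ^ 2) := by ring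
      _ ≤ _ := by
        have h7 : 3 * (e * L ^ 2 * ab * Q * a ^ 2) ≤ 3 / 32 * (Em * Q) := by linarith
        gcongr
  -- The coefficients are 35/16 = 2 + 3/32 + 3/32 and 429/256 = 3/2 + 45/256.
  linarith

/-- The bound for one round, from the bounds for its single terms. -/
theorem round_arithmetic {K G R X U Γ S2 A Bc : ℝ} (hK : 0 < K) (hη : 0 < η) (hL : 0 ≤ L)
    (he : 0 ≤ e) (hG : 0 ≤ G) (hX : 0 ≤ X) (hC : 0 ≤ C) (hEm : 0 ≤ Em) (hΓ : 0 ≤ Γ)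
    (hA : 0 ≤ A) (hBc : 0 ≤ Bc)
    (hQ : Q = β ^ 2 * G + κ ^ 2) (hu : u = max (1 - α) 0) (hη1 : L * η * u * K ≤ 1)
    (hη2 : 32 * e * L ^ 2 * β ^ 2 * C ≤ 1)
    (hR : R ≤ K * (L ^ 2 * U))
    (hU : U ≤ 9 / 4 * e * σ ^ 2 * (K * Bc) + 3 / 2 * e * C * Q * K)
    (hS2 : S2 ≤ (1 - α) * X + (Γ * (35 / 16 * Em * Q + 9 / 64 * (C * σ ^ 2))
      + 429 / 256 * σ ^ 2 * A + u * K ^ 2 * (3 * e * L ^ 2 * C * Q))) :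
    -(η / (2 * K) * (K ^ 2 * G + X - R)) + L * η ^ 2 / 2 * S2
      ≤ -(17 / 40 * (η * K) * ((1 - 4 * L * η * β ^ 2 * (1 / K * Em * Γ)) * G
        - (2 * L * η * (1 / K * A) * σ ^ 2 + 3 * e * L ^ 2 * σ ^ 2 * Bc + 6 * e * L ^ 2 * C * κ ^ 2
          + 3 * L * η * (1 / K * C * Γ) * σ ^ 2 + 4 * L * η * (1 / K * Em * Γ) * κ ^ 2))) := by
  have hσ := sq_nonneg σ
  have hκ := sq_nonneg κ
  have hu0 : 0 ≤ u := hu ▸ le_max_right _ _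
  have hQ0 : 0 ≤ Q := by rw [hQ]; positivity
  set E := 1 / K * Em * Γ with hE
  set A1 := 1 / K * A with hA1
  set D := 1 / K * C * Γ with hD
  have hE0 : 0 ≤ E := by positivity
  have hA10 : 0 ≤ A1 := by positivity
  have hD0 : 0 ≤ D := by positivity
  have e1 : Γ * Em = K * E := by rw [hE]; field_simp
  have e2 : Γ * C = K * D := by rw [hD]; field_simp
  have e3 : A = K * A1 := by rw [hA1]; field_simp
  have hR' : R ≤ K * (L ^ 2 * (9 / 4 * e * σ ^ 2 * (K * Bc) + 3 / 2 * e * C * Q * K)) :=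
    hR.trans (by gcongr)
  have hR2 : η / (2 * K) * R
      ≤ η * K / 4 * (9 / 2 * (e * L ^ 2 * σ ^ 2 * Bc) + 3 * (e * L ^ 2 * C * Q)) := by
    calc η / (2 * K) * R ≤ η / (2 * K) *
        (K * (L ^ 2 * (9 / 4 * e * σ ^ 2 * (K * Bc) + 3 / 2 * e * C * Q * K))) := by gcongr
      _ = _ := by field_simp; ring
  have hLu : L * η ^ 2 / 2 * (u * K ^ 2 * (3 * e * L ^ 2 * C * Q))
      ≤ η * K / 4 * (6 * (e * L ^ 2 * C * Q)) := by
    have h1 : (L * η * u * K) * (η * K / 4 * (6 * (e * L ^ 2 * C * Q)))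
        ≤ 1 * (η * K / 4 * (6 * (e * L ^ 2 * C * Q))) := by gcongr
    linarith
  -- The second-order (1-α) X is absorbed by the -X that polarisation supplies.
  have hX1 : L * η ^ 2 / 2 * ((1 - α) * X) ≤ η / (2 * K) * X := by
    have h1 : (1 - α) * X ≤ u * X := by
      gcongr
      exact hu ▸ le_max_left _ _
    have h2 : L * η ^ 2 / 2 * ((1 - α) * X) ≤ L * η ^ 2 / 2 * (u * X) := by gcongr
    have h3 : L * η ^ 2 / 2 * (u * X) = (L * η * u * K) * (η / (2 * K) * X) := by field_simp
    have h4 : (L * η * u * K) * (η / (2 * K) * X) ≤ 1 * (η / (2 * K) * X) := by gcongr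
    linarith
  have hS3 : L * η ^ 2 / 2 * S2 ≤ η / (2 * K) * X + η * K / 4 * (35 / 8 * (L * η * E * Q)
      + 9 / 32 * (L * η * D * σ ^ 2) + 429 / 128 * (L * η * A1 * σ ^ 2)
      + 6 * (e * L ^ 2 * C * Q)) := by
    have h1 : L * η ^ 2 / 2 * S2 ≤ L * η ^ 2 / 2 * ((1 - α) * X
      + (Γ * (35 / 16 * Em * Q + 9 / 64 * (C * σ ^ 2))
      + 429 / 256 * σ ^ 2 * A + u * K ^ 2 * (3 * e * L ^ 2 * C * Q))) := by gcongr
    have h2 : Γ * (35 / 16 * Em * Q + 9 / 64 * (C * σ ^ 2))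
        = 35 / 16 * (K * E) * Q + 9 / 64 * (K * D) * σ ^ 2 := by
      rw [← e1, ← e2]; ring
    rw [h2, e3] at h1
    linarith
  have hGK : η / (2 * K) * (K ^ 2 * G) = η * K / 4 * (2 * G) := by field_simp; ring
  -- In units of ηK/4. The drift contributes 9 e L² C β² G ≤ 9/32 G, so the factor may be at most 2
  -- - 9/32 = 55/32; the A-term 429/128 ≤ 2 · factor requires at least 429/256. The value 17/10 lies
  -- between, and 17/10 · 1/4 = 17/40.
  have hmain : -(2 * G) + (9 / 2 * (e * L ^ 2 * σ ^ 2 * Bc) + 3 * (e * L ^ 2 * C * Q))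
      + (35 / 8 * (L * η * E * Q) + 9 / 32 * (L * η * D * σ ^ 2) + 429 / 128 * (L * η * A1 * σ ^ 2)
        + 6 * (e * L ^ 2 * C * Q))
      ≤ -(17 / 10 * ((1 - 4 * L * η * β ^ 2 * E) * G
        - (2 * L * η * A1 * σ ^ 2 + 3 * e * L ^ 2 * σ ^ 2 * Bc + 6 * e * L ^ 2 * C * κ ^ 2
          + 3 * L * η * D * σ ^ 2 + 4 * L * η * E * κ ^ 2))) := by
    have t1 := mul_le_mul_of_nonneg_right hη2 hG
    have t2 : 0 ≤ L * η * β ^ 2 * E * G := by positivity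
    have t3 : 0 ≤ e * L ^ 2 * σ ^ 2 * Bc := by positivity
    have t4 : 0 ≤ e * L ^ 2 * C * κ ^ 2 := by positivity
    have t5 : 0 ≤ L * η * D * σ ^ 2 := by positivity
    have t6 : 0 ≤ L * η * A1 * σ ^ 2 := by positivity
    have t7 : 0 ≤ L * η * E * κ ^ 2 := by positivity
    rw [hQ]
    linarith
  have := mul_le_mul_of_nonneg_left hmain (by positivity : 0 ≤ η * K / 4)
  linarith

end Scalar

/-! ### Inequalities between the coefficient constants -/

section Coefficients

variable {M K : ℕ} {p : Fin M → ℝ} {a : Fin M → ℕ → ℝ}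

theorem effWeight_nonneg (hp : ∀ i, 0 ≤ p i) (hK : 0 < Keff K p a) (i : Fin M) :
    0 ≤ effWeight K p a i :=
  div_nonneg (mul_nonneg (hp i) (norm1_nonneg K _)) hK.le

theorem sum_effWeight (hK : 0 < Keff K p a) : ∑ i, effWeight K p a i = 1 := by
  simp_rw [effWeight]
  rw [← Finset.sum_div]
  exact div_self hK.ne'

theorem Keff_mul_effWeight (hK : 0 < Keff K p a) (i : Fin M) :
    Keff K p a * effWeight K p a i = p i * norm1 K (a i) :=
  mul_div_cancel₀ _ hK.ne'

theorem pos_of_Keff_pos (hK : 0 < Keff K p a) : 0 < K := by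
  rcases Nat.eq_zero_or_pos K with rfl | h
  · simp [Keff, norm1] at hK
  · exact h

theorem norm1_sub_lastCoeff_nonneg {a : ℕ → ℝ} (hK : 0 < K) (ha : ∀ k < K, 0 ≤ a k) :
    0 ≤ norm1 K a - lastCoeff K a := by
  obtain ⟨n, rfl⟩ : ∃ n, K = n + 1 := ⟨K - 1, by omega⟩
  rw [norm1_succ_sub_lastCoeff ha]
  exact Finset.sum_nonneg fun k hk => ha k (by have := Finset.mem_range.1 hk; omega)

theorem norm2sq_sub_nonneg (hK : 0 < K) (a : ℕ → ℝ) : 0 ≤ norm2sq K a - lastCoeff K a ^ 2 := by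
  obtain ⟨n, rfl⟩ : ∃ n, K = n + 1 := ⟨K - 1, by omega⟩
  rw [norm2sq_succ_sub_lastCoeff_sq]
  exact Finset.sum_nonneg fun _ _ => sq_nonneg _

theorem norm2sq_sub_le_sq {a : ℕ → ℝ} (hK : 0 < K) (ha : ∀ k < K, 0 ≤ a k) :
    norm2sq K a - lastCoeff K a ^ 2 ≤ (norm1 K a - lastCoeff K a) ^ 2 := by
  obtain ⟨n, rfl⟩ : ∃ n, K = n + 1 := ⟨K - 1, by omega⟩
  rw [norm1_succ_sub_lastCoeff ha, norm2sq_succ_sub_lastCoeff_sq]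
  exact sum_sq_le_sq_sum_range fun k hk => ha k (by omega)

theorem norm2sq_sub_mul_norm1_le {a : ℕ → ℝ} (hK : 0 < K) (ha : ∀ k < K, 0 ≤ a k) :
    (norm2sq K a - lastCoeff K a ^ 2) * norm1 K a
      ≤ 5 / 4 * (norm1 K a - lastCoeff K a) * norm2sq K a := by
  obtain ⟨n, rfl⟩ : ∃ n, K = n + 1 := ⟨K - 1, by omega⟩
  rw [norm1_succ_sub_lastCoeff ha, norm2sq_succ_sub_lastCoeff_sq, norm1_eq_sum ha]
  exact sum_sq_mul_sum_le ha

theorem constC_nonneg (hK : 0 < K) (ha : ∀ i, ∀ k < K, 0 ≤ a i k) : 0 ≤ constC K a :=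
  Real.iSup_nonneg fun i => mul_nonneg (norm1_nonneg _ _) (norm1_sub_lastCoeff_nonneg hK (ha i))

theorem le_constC (i : Fin M) :
    norm1 K (a i) * (norm1 K (a i) - lastCoeff K (a i)) ≤ constC K a :=
  le_ciSup (f := fun i => norm1 K (a i) * (norm1 K (a i) - lastCoeff K (a i)))
    (Set.finite_range _).bddAbove i

theorem constB_nonneg (hp : ∀ i, 0 ≤ p i) (hK : 0 < Keff K p a) : 0 ≤ constB K p a :=
  Finset.sum_nonneg fun i _ => mul_nonneg (effWeight_nonneg hp hK i)
    (norm2sq_sub_nonneg (pos_of_Keff_pos hK) _)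

end Coefficients

/-! ### Expected descent in one round -/

namespace RoundInputs

variable {Ω 𝒮 Z : Type*} {ℋ : MeasurableSpace Ω} [mΩ : MeasurableSpace Ω]
  [MeasurableSpace 𝒮] [MeasurableSpace Z] {d M : ℕ} {P : Measure Ω} {ν : Measure 𝒮}
  {D : Fin M → Measure Z} {𝒢 : Fin M → ℕ → MeasurableSpace Ω} {θ : Ω → Param d} {s : Ω → 𝒮}
  {ζ : Fin M → ℕ → Ω → Z} {L σ β κ ηl ηg α : ℝ} {K : ℕ} {a : Fin M → ℕ → ℝ}
  {c : Fin M → ℕ → ℕ → ℝ} {f : Fin M → Param d → ℝ} {g : Fin M → Param d → Z → Param d}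
  {ω : 𝒮 → Fin M → ℝ} {p : Fin M → ℝ} [IsProbabilityMeasure P]

/-- The aggregated deviation of the gradients is controlled by the drifts of the clients. -/
theorem integral_norm_sum_dev_sq_le (h : RoundInputs ℋ P ν D 𝒢 θ s ζ)
    (hg : ∀ i, StochasticGradient (D i) σ (f i) (g i)) (hf : ∀ i, Smooth L (f i))
    (hp : ∀ i, 0 ≤ p i) (ha : ∀ i, ∀ k < K, 0 ≤ a i k) :
    ∫ o, ‖∑ i, p i • sumDev ηl K (a i) (c i) (f i) (g i) θ (ζ i) o‖ ^ 2 ∂P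
      ≤ Keff K p a * (L ^ 2 * ∑ i, p i * ∑ k ∈ Finset.range K,
        a i k * ∫ o, ‖clientModel ηl (c i) (g i) θ (ζ i) k o - θ o‖ ^ 2 ∂P) := by
  have hi : ∀ i k, Integrable (fun o => a i k *
      ‖clientModel ηl (c i) (g i) θ (ζ i) k o - θ o‖ ^ 2) P :=
    fun i k => ((h.client i).integrable_drift (hg i) (hf i) k).const_mul _
  have hi' : ∀ i, Integrable (fun o => p i * ∑ k ∈ Finset.range K, a i k *
      ‖clientModel ηl (c i) (g i) θ (ζ i) k o - θ o‖ ^ 2) P :=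
    fun i => (integrable_finsetSum _ fun k _ => hi i k).const_mul _
  have hV : MemLp (fun o => ∑ i, p i • sumDev ηl K (a i) (c i) (f i) (g i) θ (ζ i) o) 2 P :=
    memLp_finsetSum _ fun i _ => ((h.client i).memLp_sumDev (ηl := ηl) (K := K) (a := a i)
      (c := c i) (hg i) (hf i)).const_smul (p i)
  have hRHS : ∑ i, p i * ∑ k ∈ Finset.range K,
      a i k * ∫ o, ‖clientModel ηl (c i) (g i) θ (ζ i) k o - θ o‖ ^ 2 ∂P
      = ∫ o, ∑ i, p i * ∑ k ∈ Finset.range K,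
        a i k * ‖clientModel ηl (c i) (g i) θ (ζ i) k o - θ o‖ ^ 2 ∂P := by
    rw [integral_finsetSum _ fun i _ => hi' i]
    refine Finset.sum_congr rfl fun i _ => ?_
    rw [integral_const_mul, integral_finsetSum _ fun k _ => hi i k]
    simp_rw [integral_const_mul]
  rw [hRHS, ← integral_const_mul, ← integral_const_mul]
  refine integral_mono (hV.integrable_norm_pow two_ne_zero)
    (((integrable_finsetSum _ fun i _ => hi' i).const_mul _).const_mul _) fun o => ?_
  have hw : ∀ q ∈ (Finset.univ : Finset (Fin M)) ×ˢ Finset.range K, 0 ≤ p q.1 * a q.1 q.2 :=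
    fun q hq => mul_nonneg (hp _) (ha _ _ (Finset.mem_range.1 (Finset.mem_product.1 hq).2))
  -- A single Jensen over the pairs (client, step), whose total weight is K_eff.
  have h1 := norm_sum_smul_sq_le (Finset.univ ×ˢ Finset.range K) (fun q => p q.1 * a q.1 q.2) hw
    fun q => clientDev ηl (c q.1) (f q.1) (g q.1) θ (ζ q.1) q.2 o
  have h2 : ∑ q ∈ (Finset.univ : Finset (Fin M)) ×ˢ Finset.range K, p q.1 * a q.1 q.2
      = Keff K p a := by
    rw [Finset.sum_product, Keff]
    refine Finset.sum_congr rfl fun i _ => ?_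
    rw [norm1_eq_sum (ha i), Finset.mul_sum]
  have h3 : ∑ q ∈ (Finset.univ : Finset (Fin M)) ×ˢ Finset.range K,
      (p q.1 * a q.1 q.2) • clientDev ηl (c q.1) (f q.1) (g q.1) θ (ζ q.1) q.2 o
      = ∑ i, p i • sumDev ηl K (a i) (c i) (f i) (g i) θ (ζ i) o := by
    rw [Finset.sum_product]
    refine Finset.sum_congr rfl fun i _ => ?_
    rw [sumDev, Finset.smul_sum]
    simp_rw [mul_smul]
  rw [h2, h3] at h1
  refine h1.trans (mul_le_mul_of_nonneg_left ?_ (h2 ▸ Finset.sum_nonneg hw))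
  rw [Finset.sum_product, Finset.mul_sum]
  refine Finset.sum_le_sum fun i _ => ?_
  rw [Finset.mul_sum, Finset.mul_sum]
  refine Finset.sum_le_sum fun k hk => ?_
  have h5 := pow_le_pow_left₀ (norm_nonneg _)
    ((hf i).2 (clientModel ηl (c i) (g i) θ (ζ i) k o) (θ o)) 2
  rw [mul_pow] at h5
  have h6 := mul_le_mul_of_nonneg_left h5
    (mul_nonneg (hp i) (ha i k (Finset.mem_range.1 hk)))
  simp only [clientDev]
  linarith

theorem memLp_sum_weights (h : RoundInputs ℋ P ν D 𝒢 θ s ζ)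
    (hg : ∀ i, StochasticGradient (D i) σ (f i) (g i)) (hf : ∀ i, Smooth L (f i))
    (hω : SamplingScheme ν ω p α) {F : Param d → ℝ} (hF : Smooth L F) :
    MemLp (fun o => ∑ i, ω (s o) i • sumStochGrad ηl K (a i) (c i) (f i) (g i) θ (ζ i) o) 2 P :=
  memLp_finsetSum _ fun i _ => memLp_smul_of_indepFun (h.memLp_weight hω i)
    ((h.client i).memLp_sumStochGrad (hg i) (hf i))
    ((h.indepFun_weights hg hf hω hF).comp (measurable_pi_apply i)
      ((measurable_pi_apply i).comp measurable_snd))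

/-- The inner product of the gradient with the mean direction, by polarisation. -/
theorem integral_inner_sum_sumGrad (h : RoundInputs ℋ P ν D 𝒢 θ s ζ)
    (hg : ∀ i, StochasticGradient (D i) σ (f i) (g i)) (hf : ∀ i, Smooth L (f i))
    (hp : ∀ i, 0 ≤ p i) (hK : 0 < Keff K p a) (hθ : MemLp θ 2 P) :
    ∫ o, inner ℝ (gradient (globalLoss K p a f) (θ o))
        (∑ i, p i • sumGrad ηl K (a i) (c i) (f i) (g i) θ (ζ i) o) ∂P
      = 1 / (2 * Keff K p a) *
        (Keff K p a ^ 2 * ∫ o, ‖gradient (globalLoss K p a f) (θ o)‖ ^ 2 ∂P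
        + ∫ o, ‖∑ i, p i • sumGrad ηl K (a i) (c i) (f i) (g i) θ (ζ i) o‖ ^ 2 ∂P
        - ∫ o, ‖∑ i, p i • sumDev ηl K (a i) (c i) (f i) (g i) θ (ζ i) o‖ ^ 2 ∂P) := by
  have hF : Smooth L (globalLoss K p a f) :=
    smooth_globalLoss hf (effWeight_nonneg hp hK) (sum_effWeight hK)
  have hU := memLp_two_comp_of_lipschitz hF hθ
  have hH : MemLp (fun o => ∑ i, p i • sumGrad ηl K (a i) (c i) (f i) (g i) θ (ζ i) o) 2 P :=
    memLp_finsetSum _ fun i _ => ((h.client i).memLp_sumGrad (ηl := ηl) (K := K) (a := a i)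
      (c := c i) (hg i) (hf i)).const_smul (p i)
  have hV : MemLp (fun o => ∑ i, p i • sumDev ηl K (a i) (c i) (f i) (g i) θ (ζ i) o) 2 P :=
    memLp_finsetSum _ fun i _ => ((h.client i).memLp_sumDev (ηl := ηl) (K := K) (a := a i)
      (c := c i) (hg i) (hf i)).const_smul (p i)
  have i1 := (hU.integrable_norm_pow two_ne_zero).const_mul (Keff K p a ^ 2)
  have i2 := hH.integrable_norm_pow two_ne_zero
  have i3 := hV.integrable_norm_pow two_ne_zero
  rw [← integral_const_mul, ← integral_add i1 i2]
  refine Eq.trans ?_ (congrArg _ (integral_sub (i1.add i2) i3))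
  rw [← integral_const_mul]
  refine integral_congr_ae (Filter.Eventually.of_forall fun o => ?_)
  beta_reduce
  have h1 : ∑ i, p i • sumGrad ηl K (a i) (c i) (f i) (g i) θ (ζ i) o
      = Keff K p a • gradient (globalLoss K p a f) (θ o)
        + ∑ i, p i • sumDev ηl K (a i) (c i) (f i) (g i) θ (ζ i) o := by
    rw [gradient_globalLoss K p a (fun i => (hf i).1), Finset.smul_sum, ← Finset.sum_add_distrib]
    refine Finset.sum_congr rfl fun i _ => ?_
    rw [smul_smul, Keff_mul_effWeight hK, sumGrad, smul_add, smul_smul]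
  have h2 := norm_add_sq_real (Keff K p a • gradient (globalLoss K p a f) (θ o))
    (∑ i, p i • sumDev ηl K (a i) (c i) (f i) (g i) θ (ζ i) o)
  rw [norm_smul, mul_pow, Real.norm_eq_abs, sq_abs, real_inner_smul_left] at h2
  rw [h1, h2, inner_add_right, real_inner_smul_right, real_inner_self_eq_norm_sq]
  field_simp
  ring

/-- The expected decrease of the global loss in one round. -/
theorem integral_globalLoss_next_le (h : RoundInputs ℋ P ν D 𝒢 θ s ζ)
    (hp : ∀ i, 0 ≤ p i) (ha : ∀ i, ∀ k < K, 0 ≤ a i k) (hK : 0 < Keff K p a)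
    (hc : ∀ i, ∀ k < K, ∀ s < k, 0 ≤ c i k s ∧ c i k s ≤ a i s)
    (hω : SamplingScheme ν ω p α) (hγ : ∀ i, 0 ≤ gam ν ω p α i)
    (hL : 0 ≤ L) (hf : ∀ i, Smooth L (f i)) (hg : ∀ i, StochasticGradient (D i) σ (f i) (g i))
    (hβ : 1 ≤ β) (hdis : BoundedDissimilarity β κ f (globalLoss K p a f))
    (hηg : 0 < ηg) (hηl : 0 < ηl) (hη1 : L * (ηg * ηl) * (1 - α) * Keff K p a ≤ 1)
    (hη2 : 32 * ηl ^ 2 * L ^ 2 * β ^ 2 * constC K a ≤ 1) (hθ : MemLp θ 2 P) :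
    ∫ o, globalLoss K p a f (θ o + ηg • ∑ i, ω (s o) i •
        localUpdate ηl K (a i) (c i) (g i) (fun k => ζ i k o) (θ o)) ∂P
      ≤ ∫ o, globalLoss K p a f (θ o) ∂P - 17 / 40 * (ηg * ηl * Keff K p a) *
        ((1 - constOmega ν ω K p a α L β ηg ηl) *
            ∫ o, ‖gradient (globalLoss K p a f) (θ o)‖ ^ 2 ∂P
          - (2 * L * (ηg * ηl) * (1 / Keff K p a *
              ∑ i, (variance (fun s => ω s i) ν + p i ^ 2) * norm2sq K (a i)) * σ ^ 2
            + 3 * ηl ^ 2 * L ^ 2 * σ ^ 2 * constB K p a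
            + 6 * ηl ^ 2 * L ^ 2 * constC K a * κ ^ 2
            + 3 * L * (ηg * ηl) * constD ν ω K p a α * σ ^ 2
            + 4 * L * (ηg * ηl) * constE ν ω K p a α * κ ^ 2)) := by
  have hν : IsProbabilityMeasure ν :=
    h.law ▸ Measure.isProbabilityMeasure_map h.measurable_outcome.aemeasurable
  have hF : Smooth L (globalLoss K p a f) :=
    smooth_globalLoss hf (effWeight_nonneg hp hK) (sum_effWeight hK)
  have hK0 := pos_of_Keff_pos hK
  set F := globalLoss K p a f with hFdef
  set Kf := Keff K p a with hKf
  set η := ηg * ηl with hηdef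
  have hη : 0 < η := mul_pos hηg hηl
  have hU := memLp_two_comp_of_lipschitz hF hθ
  set G := ∫ o, ‖gradient F (θ o)‖ ^ 2 ∂P with hGdef
  have hG0 : 0 ≤ G := integral_nonneg fun _ => sq_nonneg _
  set Q := β ^ 2 * G + κ ^ 2 with hQ
  have hQ0 : 0 ≤ Q := by positivity
  set N : Fin M → ℝ := fun i => ∫ o, ‖gradient (f i) (θ o)‖ ^ 2 ∂P with hN
  have hNQ : ∀ i, N i ≤ Q := by
    intro i
    have hpt : ∀ x, ‖gradient (f i) x‖ ^ 2 ≤ β ^ 2 * ‖gradient F x‖ ^ 2 + κ ^ 2 := by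
      intro x
      -- A point mass as weight vector bounds the gradient of each single client.
      have := hdis (Pi.single i 1) (fun j => by
        by_cases hj : j = i
        · subst hj; simp
        · simp [Pi.single_eq_of_ne hj]) (by simp) x
      simpa [Pi.single_apply, Finset.sum_ite_eq'] using this
    have i1 := (hU.integrable_norm_pow two_ne_zero).const_mul (β ^ 2)
    have := integral_mono ((h.client i).integrable_gradient_sq (hf i))
      (i1.add (integrable_const (κ ^ 2))) fun o => hpt (θ o)
    refine this.trans (le_of_eq ?_)
    simp only [Pi.add_apply]
    rw [integral_add i1 (integrable_const _), integral_const_mul]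
    simp [hQ, hGdef]
  have hC0 := constC_nonneg hK0 ha
  set C := constC K a with hC
  set Em := ⨆ i, norm1 K (a i) ^ 2 with hEm
  have hEm0 : 0 ≤ Em := Real.iSup_nonneg fun i => sq_nonneg _
  have haE : ∀ i, norm1 K (a i) ^ 2 ≤ Em := fun i =>
    le_ciSup (f := fun i => norm1 K (a i) ^ 2) (Set.finite_range _).bddAbove i
  set e := ηl ^ 2 with he
  have he0 : 0 ≤ e := sq_nonneg _
  set ab : Fin M → ℝ := fun i => norm1 K (a i) * (norm1 K (a i) - lastCoeff K (a i)) with hab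
  have hab0 : ∀ i, 0 ≤ ab i := fun i =>
    mul_nonneg (norm1_nonneg _ _) (norm1_sub_lastCoeff_nonneg hK0 (ha i))
  have habC : ∀ i, ab i ≤ C := fun i => le_constC i
  have hsmall : ∀ i, 32 * e * L ^ 2 * ab i ≤ 1 := by
    intro i
    have h1 : 32 * e * L ^ 2 * ab i ≤ 32 * e * L ^ 2 * C := by gcongr; exact habC i
    -- The condition contains β²; since β ≥ 1 it implies the version without it.
    have h2 : 32 * e * L ^ 2 * C * 1 ≤ 32 * e * L ^ 2 * C * β ^ 2 := by
      gcongr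
      exact one_le_pow₀ hβ
    linarith
  set B : Fin M → ℝ := fun i => norm2sq K (a i) - lastCoeff K (a i) ^ 2 with hB
  have heL : 0 ≤ 32 * e * L ^ 2 := by positivity
  have hB1 : ∀ i, 32 * e * L ^ 2 * (norm1 K (a i) ^ 2 * B i) ≤ ab i := by
    intro i
    have h1 := mul_le_mul_of_nonneg_left (norm2sq_sub_le_sq hK0 (ha i))
      (mul_nonneg heL (sq_nonneg (norm1 K (a i))))
    have h2 := mul_le_mul_of_nonneg_right (hsmall i) (hab0 i)
    have h3 : 32 * e * L ^ 2 * norm1 K (a i) ^ 2 * (norm1 K (a i) - lastCoeff K (a i)) ^ 2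
      = 32 * e * L ^ 2 * ab i * ab i := by rw [hab]; ring
    rw [h3] at h1
    linarith
  have hB2 : ∀ i, 32 * e * L ^ 2 * (norm1 K (a i) ^ 2 * B i) ≤ 5 / 4 * norm2sq K (a i) := by
    intro i
    have h1 := mul_le_mul_of_nonneg_left (norm2sq_sub_mul_norm1_le hK0 (ha i))
      (mul_nonneg heL (norm1_nonneg K (a i)))
    have h2 := mul_le_mul_of_nonneg_right (hsmall i)
      (mul_nonneg (by norm_num : (0 : ℝ) ≤ 5 / 4) (norm2sq_nonneg K (a i)))
    have h3 : 32 * e * L ^ 2 * norm1 K (a i) *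
      (5 / 4 * (norm1 K (a i) - lastCoeff K (a i)) * norm2sq K (a i))
      = 32 * e * L ^ 2 * ab i * (5 / 4 * norm2sq K (a i)) := by rw [hab]; ring
    rw [h3] at h1
    linarith
  set U : Fin M → ℝ := fun i => ∑ k ∈ Finset.range K,
    a i k * ∫ o, ‖clientModel ηl (c i) (g i) θ (ζ i) k o - θ o‖ ^ 2 ∂P with hUdef
  have hUi : ∀ i, U i ≤ norm1 K (a i) * (9 / 4 * e * (σ ^ 2 * B i) + 3 / 2 * e * ab i * N i) :=
    fun i => (h.client i).sum_integral_drift_le_norm (hg i) (hf i) hK0 (ha i) (hc i) (hsmall i)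
  set v : Fin M → ℝ := fun i =>
    ∫ o, ‖sumDev ηl K (a i) (c i) (f i) (g i) θ (ζ i) o‖ ^ 2 ∂P with hvdef
  have hv : ∀ i, v i ≤ norm1 K (a i) ^ 2 * L ^ 2 *
      (9 / 4 * e * (σ ^ 2 * B i) + 3 / 2 * e * ab i * N i) := by
    intro i
    have h1 := (h.client i).integral_sumDev_sq_le (ηl := ηl) (c := c i) (hg i) (hf i) (ha i)
    have h2 := mul_le_mul_of_nonneg_left (hUi i)
      (mul_nonneg (norm1_nonneg K (a i)) (sq_nonneg L))
    linarith
  -- The positive part keeps the step-size condition, which is trivial for α > 1, and gives a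
  -- nonnegative multiplier for the estimates.
  set u := max (1 - α) 0 with hu
  have hη1' : L * η * u * Kf ≤ 1 := by
    rcases le_total (1 - α) 0 with h1 | h1
    · rw [hu, max_eq_right h1]; simp
    · rw [hu, max_eq_left h1]; exact hη1
  set wt : Fin M → ℝ := fun i => variance (fun s => ω s i) ν + p i ^ 2 with hwt
  have hwt0 : ∀ i, 0 ≤ wt i := fun i => add_nonneg (variance_nonneg _ _) (sq_nonneg _)
  have hwtγ : ∀ i, wt i ≤ gam ν ω p α i + u * p i ^ 2 := by
    intro i
    have := mul_le_mul_of_nonneg_right (le_max_left (1 - α) 0) (sq_nonneg (p i))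
    rw [hwt, gam]
    linarith
  set Γ := ∑ i, gam ν ω p α i with hΓ
  have hΓ0 : 0 ≤ Γ := Finset.sum_nonneg fun i _ => hγ i
  have hΓ' : (∑ i, variance (fun s => ω s i) ν) + α * ∑ i, p i ^ 2 = Γ := by
    rw [hΓ, Finset.mul_sum, ← Finset.sum_add_distrib]
    rfl
  have hpa : ∑ i, (p i * norm1 K (a i)) ^ 2 ≤ Kf ^ 2 :=
    Finset.sum_sq_le_sq_sum_of_nonneg fun i _ => mul_nonneg (hp i) (norm1_nonneg _ _)
  set X := ∫ o, ‖∑ i, p i • sumGrad ηl K (a i) (c i) (f i) (g i) θ (ζ i) o‖ ^ 2 ∂P with hX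
  set R := ∫ o, ‖∑ i, p i • sumDev ηl K (a i) (c i) (f i) (g i) θ (ζ i) o‖ ^ 2 ∂P with hR
  set S2 := ∫ o, ‖∑ i, ω (s o) i • sumStochGrad ηl K (a i) (c i) (f i) (g i) θ (ζ i) o‖ ^ 2 ∂P
    with hS2
  have hS2le : S2 ≤ (1 - α) * X + (Γ * (35 / 16 * Em * Q + 9 / 64 * (C * σ ^ 2))
      + 429 / 256 * σ ^ 2 * ∑ i, wt i * norm2sq K (a i)
      + u * Kf ^ 2 * (3 * e * L ^ 2 * C * Q)) := by
    refine (h.integral_norm_sum_weights_sq_le hg hf hω hγ hF).trans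
      (add_le_add_right ?_ _)
    calc _ ≤ ∑ i, (gam ν ω p α i * (35 / 16 * Em * Q + 9 / 64 * (C * σ ^ 2))
          + 429 / 256 * σ ^ 2 * (wt i * norm2sq K (a i))
          + u * (p i * norm1 K (a i)) ^ 2 * (3 * e * L ^ 2 * C * Q)) :=
        Finset.sum_le_sum fun i _ => client_second_moment_le he0 hQ0 (hab0 i) (habC i) (haE i)
          (hNQ i) (hsmall i) (hB1 i) (hB2 i) (hv i) (hγ i) (hwt0 i) (hwtγ i) (le_max_right _ _)
      _ = Γ * (35 / 16 * Em * Q + 9 / 64 * (C * σ ^ 2))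
          + 429 / 256 * σ ^ 2 * ∑ i, wt i * norm2sq K (a i)
          + u * (∑ i, (p i * norm1 K (a i)) ^ 2) * (3 * e * L ^ 2 * C * Q) := by
        rw [Finset.sum_add_distrib, Finset.sum_add_distrib, ← Finset.sum_mul, ← Finset.mul_sum,
          ← Finset.sum_mul, ← Finset.mul_sum]
      _ ≤ _ := by
        have : 0 ≤ u := le_max_right _ _
        gcongr
  have hRle : R ≤ Kf * (L ^ 2 * ∑ i, p i * U i) := h.integral_norm_sum_dev_sq_le hg hf hp ha
  have hUle : ∑ i, p i * U i ≤ 9 / 4 * e * σ ^ 2 * (Kf * constB K p a)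
      + 3 / 2 * e * C * Q * Kf := by
    calc ∑ i, p i * U i ≤ ∑ i, (9 / 4 * e * σ ^ 2 * (Kf * (effWeight K p a i * B i))
          + 3 / 2 * e * C * Q * (p i * norm1 K (a i))) := by
          refine Finset.sum_le_sum fun i _ => ?_
          rw [← mul_assoc Kf, Keff_mul_effWeight hK]
          have h1 := mul_le_mul_of_nonneg_left (hUi i) (hp i)
          have h2 : ab i * N i ≤ C * Q :=
            mul_le_mul (habC i) (hNQ i) (integral_nonneg fun _ => sq_nonneg _) hC0
          have h3 := mul_le_mul_of_nonneg_left h2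
            (mul_nonneg (mul_nonneg (hp i) (norm1_nonneg K (a i)))
              (by positivity : 0 ≤ 3 / 2 * e))
          linarith
      _ = _ := by
          rw [Finset.sum_add_distrib, ← Finset.mul_sum, ← Finset.mul_sum, ← Finset.mul_sum]
          rfl
  have hfinal := round_arithmetic (α := α) hK hη hL he0 hG0 (integral_nonneg fun _ => sq_nonneg _)
    hC0 hEm0 hΓ0 (Finset.sum_nonneg fun i _ => mul_nonneg (hwt0 i) (norm2sq_nonneg K (a i)))
    (constB_nonneg hp hK) hQ hu hη1' hη2 hRle hUle hS2le
  have hnext : ∀ o, θ o + ηg • ∑ i, ω (s o) i •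
      localUpdate ηl K (a i) (c i) (g i) (fun k => ζ i k o) (θ o)
      = θ o - η • ∑ i, ω (s o) i • sumStochGrad ηl K (a i) (c i) (f i) (g i) θ (ζ i) o := by
    intro o
    simp_rw [fun i => localUpdate_eq ηl (ha i) (c i) (f i) (g i) θ (ζ i) o, smul_neg,
      Finset.sum_neg_distrib, smul_neg, smul_comm (_ : ℝ) ηl]
    rw [← Finset.smul_sum, smul_smul, sub_eq_add_neg]
  simp_rw [hnext]
  have hW := h.memLp_sum_weights (ηl := ηl) (K := K) (a := a) (c := c) hg hf hω hF
  have j1 := hF.integrable_comp hθ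
  have j2 := (integrable_inner_of_memLp_two hU hW).const_mul (-η)
  have j3 := (hW.integrable_norm_pow two_ne_zero).const_mul (L * η ^ 2 / 2)
  have hdesc : ∫ o, F (θ o - η • ∑ i, ω (s o) i •
      sumStochGrad ηl K (a i) (c i) (f i) (g i) θ (ζ i) o) ∂P
      ≤ ∫ o, F (θ o) ∂P + -η * ∫ o, inner ℝ (gradient F (θ o)) (∑ i, ω (s o) i •
        sumStochGrad ηl K (a i) (c i) (f i) (g i) θ (ζ i) o) ∂P + L * η ^ 2 / 2 * S2 := by
    rw [hS2, ← integral_const_mul, ← integral_const_mul, ← integral_add j1 j2]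
    refine le_trans ?_ (le_of_eq (integral_add (j1.add j2) j3))
    refine integral_mono (hF.integrable_comp (hθ.sub (hW.const_smul η))) ((j1.add j2).add j3)
      fun o => ?_
    have h1 := hF.le_quadratic (θ o) (θ o - η • ∑ i, ω (s o) i •
      sumStochGrad ηl K (a i) (c i) (f i) (g i) θ (ζ i) o)
    rw [sub_sub_cancel_left, inner_neg_right, norm_neg, real_inner_smul_right, norm_smul, mul_pow,
      Real.norm_eq_abs, sq_abs] at h1
    beta_reduce
    linarith
  rw [h.integral_inner_sum_weights hg hf hω hF hθ,
    h.integral_inner_sum_sumGrad hg hf hp hK hθ] at hdesc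
  have hOm : constOmega ν ω K p a α L β ηg ηl = 4 * L * η * β ^ 2 * (1 / Kf * Em * Γ) := by
    rw [constOmega, constE, hΓ']
  have hD : constD ν ω K p a α = 1 / Kf * C * Γ := by rw [constD, hΓ']
  have hE : constE ν ω K p a α = 1 / Kf * Em * Γ := by rw [constE, hΓ']
  rw [hOm, hD, hE]
  have hre : η / (2 * Kf) * (Kf ^ 2 * G + X - R) = η * (1 / (2 * Kf) * (Kf ^ 2 * G + X - R)) := by
    ring
  rw [hre] at hfinal
  linarith

end RoundInputs

/-! ### The sequence of global models -/

theorem measurable_localUpdate {Ω Z : Type*} [MeasurableSpace Ω] [MeasurableSpace Z] {d : ℕ}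
    (ηl : ℝ) (K : ℕ) (a : ℕ → ℝ) (c : ℕ → ℕ → ℝ) {g : Param d → Z → Param d}
    (hg : Measurable fun q : Param d × Z => g q.1 q.2) {θ : Ω → Param d} (hθ : Measurable θ)
    {ζ : ℕ → Ω → Z} (hζ : ∀ k, Measurable (ζ k)) :
    Measurable fun o => localUpdate ηl K a c g (fun k => ζ k o) (θ o) :=
  (Measurable.const_smul (Finset.measurable_fun_sum _ fun k _ => (hg.comp
    ((measurable_localModel ηl c hg hθ k fun s _ => hζ s).prodMk (hζ k))).const_smul (a k))
      ηl).neg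

theorem measurable_globalModel {Ω 𝒮 Z : Type*} [MeasurableSpace Ω] [MeasurableSpace 𝒮]
    [MeasurableSpace Z] {d M : ℕ} (ηg ηl : ℝ) (K : ℕ) (a : Fin M → ℕ → ℝ)
    (c : Fin M → ℕ → ℕ → ℝ) {g : Fin M → Param d → Z → Param d}
    (hg : ∀ i, Measurable fun q : Param d × Z => g i q.1 q.2) (θ₀ : Param d)
    {ω : 𝒮 → Fin M → ℝ} (hω : ∀ i, Measurable fun s => ω s i) {S : ℕ → Ω → 𝒮}
    {ξ : ℕ × Fin M × ℕ → Ω → Z} (t : ℕ) (hS : ∀ r < t, Measurable (S r))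
    (hξ : ∀ r < t, ∀ i k, Measurable (ξ (r, i, k))) :
    Measurable fun o => globalModel ηg ηl K a c g θ₀ (fun r => ω (S r o))
      (fun r i k => ξ (r, i, k) o) t := by
  induction t with
  | zero => exact measurable_const
  | succ t ih =>
    have hθ := ih (fun r hr => hS r (by omega)) fun r hr => hξ r (by omega)
    refine hθ.add (Measurable.const_smul (Finset.measurable_fun_sum _ fun i _ => ?_) ηg)
    exact ((hω i).comp (hS t (by omega))).smul
      (measurable_localUpdate ηl K (a i) (c i) (hg i) hθ (hξ t (by omega) i))

theorem measurable_of_mem_biSup {Ω β ι : Type*} [MeasurableSpace β] {m : ι → MeasurableSpace Ω}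
    {J : Set ι} {j : ι} (hj : j ∈ J) {X : Ω → β} (hX : Measurable[m j] X) :
    Measurable[⨆ i ∈ J, m i] X :=
  hX.mono (le_iSup₂_of_le j hj le_rfl) le_rfl

/-- The information attached to an input is generated by all the other inputs, future ones included,
so it is no filtration. It suffices that it contains what determines the quantities tested against
that input, and θ^t depends on rounds before t only. -/
theorem RandomInputs.roundInputs {M d : ℕ} {Ω 𝒮 Z : Type*} [MeasurableSpace Ω]
    [MeasurableSpace 𝒮] [MeasurableSpace Z] {P : Measure Ω} {ν : Measure 𝒮} {D : Fin M → Measure Z}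
    {S : ℕ → Ω → 𝒮} {ξ : ℕ × Fin M × ℕ → Ω → Z} (hin : RandomInputs P ν D S ξ) (ηg ηl : ℝ) (K : ℕ)
    (a : Fin M → ℕ → ℝ) (c : Fin M → ℕ → ℕ → ℝ) {g : Fin M → Param d → Z → Param d}
    (hg : ∀ i, Measurable fun q : Param d × Z => g i q.1 q.2) (θ₀ : Param d)
    {ω : 𝒮 → Fin M → ℝ} (hω : ∀ i, Measurable fun s => ω s i) (t : ℕ)
    (hθ : MemLp (fun o => globalModel ηg ηl K a c g θ₀ (fun r => ω (S r o))
      (fun r i k => ξ (r, i, k) o) t) 2 P) :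
    RoundInputs (⨆ j ∈ ({Sum.inl t}ᶜ : Set _), inputAlgebra S ξ j) P ν D
      (fun i k => ⨆ j ∈ ({Sum.inr (t, i, k)}ᶜ : Set _), inputAlgebra S ξ j)
      (fun o => globalModel ηg ηl K a c g θ₀ (fun r => ω (S r o)) (fun r i k => ξ (r, i, k) o) t)
      (S t) (fun i k => ξ (t, i, k)) := by
  have hle : ∀ j, inputAlgebra S ξ j ≤ ‹MeasurableSpace Ω› := by
    rintro (r | j)
    · exact (hin.measurable_S r).comap_le
    · exact (hin.measurable_ξ j).comap_le
  have hind := iIndep_inputAlgebra hin.indep_S hin.indep_ξ hin.indep_S_ξ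
  have hSm : ∀ J : Set (ℕ ⊕ (ℕ × Fin M × ℕ)), ∀ r, Sum.inl r ∈ J →
      Measurable[⨆ j ∈ J, inputAlgebra S ξ j] (S r) := fun J r hr =>
    measurable_of_mem_biSup hr (comap_measurable (S r))
  have hξm : ∀ J : Set (ℕ ⊕ (ℕ × Fin M × ℕ)), ∀ j, Sum.inr j ∈ J →
      Measurable[⨆ j ∈ J, inputAlgebra S ξ j] (ξ j) := fun J j hj =>
    measurable_of_mem_biSup hj (comap_measurable (ξ j))
  have hstart : ∀ J : Set (ℕ ⊕ (ℕ × Fin M × ℕ)), (∀ r < t, Sum.inl r ∈ J) →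
      (∀ r < t, ∀ i k, Sum.inr (r, i, k) ∈ J) →
      Measurable[⨆ j ∈ J, inputAlgebra S ξ j] fun o => globalModel ηg ηl K a c g θ₀
        (fun r => ω (S r o)) (fun r i k => ξ (r, i, k) o) t := fun J h1 h2 =>
    @measurable_globalModel Ω 𝒮 Z (⨆ j ∈ J, inputAlgebra S ξ j) _ _ d M ηg ηl K a c g hg θ₀ ω hω S
      ξ t (fun r hr => hSm J r (h1 r hr)) fun r hr i k => hξm J _ (h2 r hr i k)
  refine
    { client := fun i =>
        { le := fun k => iSup₂_le fun j _ => hle j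
          measurable_start := fun k => hstart _ (by simp) fun r hr j l => by
            simp only [Set.mem_compl_iff, Set.mem_singleton_iff, Sum.inr.injEq, Prod.mk.injEq]
            omega
          measurable_past := fun k r hr => hξm _ _ (by simp; omega)
          measurable := fun k => hin.measurable_ξ _
          law := fun k => hin.law_ξ (t, i, k)
          indep := fun k => indep_biSup_compl_singleton hle hind (Sum.inr (t, i, k))
          memLp := hθ }
      measurable_other := fun i k j hj r => hξm _ _ (by simp [hj])
      measurable_start := hstart _ (fun r hr => by simp; omega) (by simp)
      measurable_batch := fun i k => hξm _ _ (by simp)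
      measurable_outcome := hin.measurable_S t
      law := hin.law_S t
      indep := indep_biSup_compl_singleton hle hind (Sum.inl t) }

/-- Square integrability passes from round to round: it is needed to set up a round, and the
independence of weights and updates within the round returns it for the next model. -/
theorem RandomInputs.memLp_globalModel {M d : ℕ} {Ω 𝒮 Z : Type*} [MeasurableSpace Ω]
    [MeasurableSpace 𝒮] [MeasurableSpace Z] {P : Measure Ω} [IsProbabilityMeasure P]
    {ν : Measure 𝒮} {D : Fin M → Measure Z} {S : ℕ → Ω → 𝒮} {ξ : ℕ × Fin M × ℕ → Ω → Z}
    (hin : RandomInputs P ν D S ξ) (ηg ηl : ℝ) {K : ℕ} {a : Fin M → ℕ → ℝ}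
    (ha : ∀ i, ∀ k < K, 0 ≤ a i k) (c : Fin M → ℕ → ℕ → ℝ) {L σ α : ℝ} {p : Fin M → ℝ}
    {f : Fin M → Param d → ℝ} (hf : ∀ i, Smooth L (f i)) {F : Param d → ℝ} (hF : Smooth L F)
    {g : Fin M → Param d → Z → Param d} (hg : ∀ i, StochasticGradient (D i) σ (f i) (g i))
    (θ₀ : Param d) {ω : 𝒮 → Fin M → ℝ} (hω : SamplingScheme ν ω p α) (t : ℕ) :
    MemLp (fun o => globalModel ηg ηl K a c g θ₀ (fun r => ω (S r o))
      (fun r i k => ξ (r, i, k) o) t) 2 P := by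
  induction t with
  | zero => exact memLp_const θ₀
  | succ t ih =>
    have h := hin.roundInputs ηg ηl K a c (fun i => (hg i).measurable) θ₀ hω.measurable t ih
    have hW := h.memLp_sum_weights (ηl := ηl) (K := K) (a := a) (c := c) hg hf hω hF
    refine (ih.sub (hW.const_smul (ηg * ηl))).congr_norm ?_ (Filter.Eventually.of_forall fun o => ?_)
    · exact (measurable_globalModel ηg ηl K a c (fun i => (hg i).measurable) θ₀ hω.measurable (t + 1)
        (fun r _ => hin.measurable_S r) fun r _ i k => hin.measurable_ξ _).aestronglyMeasurable
    · rw [globalModel]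
      simp_rw [fun i => localUpdate_eq ηl (ha i) (c i) (f i) (g i) (fun o => globalModel ηg ηl K a c
        g θ₀ (fun r => ω (S r o)) (fun r i k => ξ (r, i, k) o) t) (fun k => ξ (t, i, k)) o,
        smul_neg, Finset.sum_neg_distrib, smul_neg, smul_comm (_ : ℝ) ηl]
      rw [← Finset.smul_sum, smul_smul, ← sub_eq_add_neg]
      rfl

theorem constE_nonneg {M K : ℕ} {𝒮 : Type*} [MeasurableSpace 𝒮] {ν : Measure 𝒮}
    {ω : 𝒮 → Fin M → ℝ} {p : Fin M → ℝ} {a : Fin M → ℕ → ℝ} {α : ℝ} (hK : 0 < Keff K p a)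
    (hγ : ∀ i, 0 ≤ gam ν ω p α i) : 0 ≤ constE ν ω K p a α := by
  refine mul_nonneg (mul_nonneg (one_div_nonneg.2 hK.le)
    (Real.iSup_nonneg fun i => sq_nonneg _)) ?_
  rw [Finset.mul_sum, ← Finset.sum_add_distrib]
  exact Finset.sum_nonneg fun i _ => hγ i

/-- Averaging a one-step decrease inequality over the steps. -/
theorem average_le_of_descent {Φ G : ℕ → ℝ} {w r Y Φmin : ℝ} {T : ℕ} (hT : 0 < T) (hw : 0 < w)
    (hr : 0 < r) (hmin : Φmin ≤ Φ T) (h0 : Φmin ≤ Φ 0)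
    (hstep : ∀ t, Φ (t + 1) ≤ Φ t - 17 / 40 * w * (r * G t - Y)) :
    1 / (T : ℝ) * ∑ t ∈ Finset.range T, G t ≤ 4 * ((Φ 0 - Φmin) / (r * w * T)) + 1 / r * Y := by
  have hT' : (0 : ℝ) < T := by exact_mod_cast hT
  have hsum : ∀ n : ℕ, 17 / 40 * w * (r * ∑ t ∈ Finset.range n, G t - n * Y) ≤ Φ 0 - Φ n := by
    intro n
    induction n with
    | zero => simp
    | succ n ih =>
      rw [Finset.sum_range_succ]
      push_cast
      linarith [hstep n]
  have h1 := hsum T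
  -- The factor 40/17 is enlarged to 4 in front of the initial gap, which is nonnegative, and to
  -- cancel exactly in front of Y.
  have h2 : r * ∑ t ∈ Finset.range T, G t ≤ 4 * (Φ 0 - Φmin) / w + T * Y := by
    have h3 : 17 / 40 * (r * ∑ t ∈ Finset.range T, G t - T * Y) ≤ (Φ 0 - Φmin) / w := by
      rw [le_div_iff₀ hw]
      linarith
    have h4 : 0 ≤ (Φ 0 - Φmin) / w := div_nonneg (by linarith) hw.le
    have h5 : 4 * (Φ 0 - Φmin) / w = 4 * ((Φ 0 - Φmin) / w) := by ring
    rw [h5]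
    linarith
  have h6 : 1 / (T : ℝ) * ∑ t ∈ Finset.range T, G t
      = 1 / (r * T) * (r * ∑ t ∈ Finset.range T, G t) := by field_simp
  rw [h6]
  refine (mul_le_mul_of_nonneg_left h2 (by positivity)).trans (le_of_eq ?_)
  field_simp

end FedLearning

/-! ### The averaged bound -/

open FedLearning in
theorem mainTheorem2
    {d M : ℕ}
    {Ω 𝒮 Z : Type*} [MeasurableSpace Ω] [MeasurableSpace 𝒮] [MeasurableSpace Z]
    (P : Measure Ω) [IsProbabilityMeasure P]
    -- the clients: importances, losses, batch laws, stochastic gradients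
    (p : Fin M → ℝ) (hp : ∀ i, 0 ≤ p i) (hp1 : ∑ i, p i = 1)
    (f : Fin M → Param d → ℝ) (D : Fin M → Measure Z) (g : Fin M → Param d → Z → Param d)
    -- the local work: coefficient vectors and the weights of the intermediate local models
    (K : ℕ) (a : Fin M → ℕ → ℝ) (ha : ∀ i, ∀ k < K, 0 ≤ a i k) (hKeff : 0 < Keff K p a)
    (c : Fin M → ℕ → ℕ → ℝ) (hc : ∀ i, ∀ k < K, ∀ s < k, 0 ≤ c i k s ∧ c i k s ≤ a i s)
    -- the client sampling
    (ν : Measure 𝒮) (ω : 𝒮 → Fin M → ℝ) (α : ℝ) (hω : SamplingScheme ν ω p α)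
    (hγ : ∀ i, 0 ≤ gam ν ω p α i) (m : ℕ) (hm : 0 < m)
    -- the randomness
    (S : ℕ → Ω → 𝒮) (ξ : ℕ × Fin M × ℕ → Ω → Z) (hin : RandomInputs P ν D S ξ)
    -- smoothness, unbiased gradients with bounded variance, bounded dissimilarity
    (L σ β κ : ℝ) (hL : 0 ≤ L) (hsmooth : ∀ i, Smooth L (f i))
    (hg : ∀ i, StochasticGradient (D i) σ (f i) (g i))
    (hβ : 1 ≤ β) (hdis : BoundedDissimilarity β κ f (globalLoss K p a f))
    -- the learning rates
    (ηg ηl : ℝ) (hηg : 0 < ηg) (hηl : 0 < ηl)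
    (hη1 : L * (ηg * ηl) * (1 - α) * Keff K p a ≤ 1)
    (hη2 : 32 * ηl ^ 2 * L ^ 2 * β ^ 2 * constC K a ≤ 1)
    (hΩ : constOmega ν ω K p a α L β ηg ηl < 1)
    -- the initial model, an optimal model, the number of rounds
    (θ₀ θopt : Param d) (hopt : ∀ x, globalLoss K p a f θopt ≤ globalLoss K p a f x)
    (T : ℕ) (hT : 0 < T) :
    let θ : ℕ → Ω → Param d := fun t o =>
      globalModel ηg ηl K a c g θ₀ (fun r => ω (S r o)) (fun r i k => ξ (r, i, k) o) t
    let F : Param d → ℝ := globalLoss K p a f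
    let η : ℝ := ηg * ηl
    let Om : ℝ := constOmega ν ω K p a α L β ηg ηl
    let A' : ℝ := 1 / (1 - Om) * constA ν ω m K p a
    let B' : ℝ := 1 / (1 - Om) * constB K p a
    let C' : ℝ := 1 / (1 - Om) * constC K a
    let D' : ℝ := 1 / (1 - Om) * constD ν ω K p a α
    let E' : ℝ := 1 / (1 - Om) * constE ν ω K p a α
    (∀ t, Integrable (fun o => ‖gradient F (θ t o)‖ ^ 2) P) ∧
    1 / (T : ℝ) * ∑ t ∈ Finset.range T, ∫ o, ‖gradient F (θ t o)‖ ^ 2 ∂P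
      ≤ 4 * ((F θ₀ - F θopt) / ((1 - Om) * η * Keff K p a * T))
        + 2 * L * η * A' * σ ^ 2 * (1 / (m : ℝ))
        + 3 * ηl ^ 2 * L ^ 2 * σ ^ 2 * B'
        + 6 * ηl ^ 2 * L ^ 2 * C' * κ ^ 2
        + 3 * L * η * D' * σ ^ 2
        + 4 * L * (L ^ 2 / 2 + 1) * η * E' * κ ^ 2 := by

  have hF : Smooth L (globalLoss K p a f) :=
    smooth_globalLoss hsmooth (effWeight_nonneg hp hKeff) (sum_effWeight hKeff)
  have hθ := hin.memLp_globalModel ηg ηl ha c hsmooth hF hg θ₀ hω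
  intro θ F η Om A' B' C' D' E'
  have hG : ∀ t, Integrable (fun o => ‖gradient F (θ t o)‖ ^ 2) P := fun t =>
    (memLp_two_comp_of_lipschitz hF (hθ t)).integrable_norm_pow two_ne_zero
  refine ⟨hG, ?_⟩
  have hm' : (m : ℝ) ≠ 0 := by exact_mod_cast hm.ne'
  have hlow : ∀ t, F θopt ≤ ∫ o, F (θ t o) ∂P := by
    intro t
    have := integral_mono (μ := P) (integrable_const (F θopt)) (hF.integrable_comp (hθ t))
      fun o => hopt (θ t o)
    simpa using this
  have hΦ0 : ∫ o, F (θ 0 o) ∂P = F θ₀ := by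
    simp [θ, globalModel]
  have hmain := average_le_of_descent (Φ := fun t => ∫ o, F (θ t o) ∂P)
    (G := fun t => ∫ o, ‖gradient F (θ t o)‖ ^ 2 ∂P) hT
    (mul_pos (mul_pos hηg hηl) hKeff) (sub_pos.2 hΩ) (hlow T) (hlow 0)
    fun t => (hin.roundInputs ηg ηl K a c (fun i => (hg i).measurable) θ₀ hω.measurable t
      (hθ t)).integral_globalLoss_next_le hp ha hKeff hc hω hγ hL hsmooth hg hβ hdis hηg hηl hη1
        hη2 (hθ t)
  rw [hΦ0] at hmain
  have hOm : 0 < 1 - Om := sub_pos.2 hΩ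
  -- The descent argument yields the coefficient 4 L η E' of κ²; the summand L²/2 in the stated
  -- bound is nonnegative slack.
  have hE0 : 0 ≤ L * η * κ ^ 2 * (L ^ 2 * E') :=
    mul_nonneg (mul_nonneg (mul_nonneg hL (mul_pos hηg hηl).le) (sq_nonneg κ))
      (mul_nonneg (sq_nonneg L) (mul_nonneg (one_div_nonneg.2 hOm.le) (constE_nonneg hKeff hγ)))
  -- The factor m in the definition of A cancels against 1/m.
  have hA : A' * (1 / (m : ℝ)) = 1 / (1 - Om) * (1 / Keff K p a *
      ∑ i, (variance (fun s => ω s i) ν + p i ^ 2) * norm2sq K (a i)) := by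
    simp only [A', constA]
    field_simp
  have hden : (1 - Om) * (ηg * ηl * Keff K p a) * (T : ℝ) = (1 - Om) * η * Keff K p a * T := by
    ring
  rw [← hden]
  refine hmain.trans ?_
  have hA2 : 2 * L * η * A' * σ ^ 2 * (1 / (m : ℝ))
      = 2 * L * η * σ ^ 2 * (A' * (1 / (m : ℝ))) := by ring
  rw [hA2, hA]
  simp only [B', C', D', E', Om, F, η] at hE0 ⊢
  linarith
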